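/- Let $R\subset\mathbb{R}^d$ be a root system, i.e. a finite set of nonzero vectors with $\sigma_\alpha(R)=R$ for all $\alpha\in R$, where $\sigma_\alpha x=x-2\langle x,\alpha\rangle\alpha/\|\alpha\|^2$. Let $G$ be the group generated by the $\sigma_\alpha$ ($\alpha\in R$), let $k:R\to\mathbb{C}$ be $G$-invariant, let $\beta\in\mathbb{R}^d$ satisfy $\langle\alpha,\beta\rangle\neq0$ for all $\alpha\in R$, and put $R_+=\{\alpha\in R:\langle\alpha,\beta\rangle>0\}$. For $f\in C^1(\mathbb{R}^d)$ and $\xi\in\mathbb{R}^d$ the Dunkl operator is $$T_\xi f(x)=\partial_\xi f(x)+\sum_{\alpha\in R_+}k(\alpha)\langle\alpha,\xi\rangle\frac{f(x)-f(\sigma_\alpha x)}{\langle\alpha,x\rangle},$$ where the quotients are extended by continuity to $\langle\alpha,x\rangle=0$ (with value $2\,\partial_\alpha f(x)/\|\alpha\|^2$ there); $T_j:=T_{e_j}$. Let $\mathcal P$ be the space of complex polynomial functions on $\mathbb{R}^d$ and $\mathcal P_n$ its subspace of homogeneous polynomials of degree $n$. Assume that $k\in M^*$, i.e. that for every $n\ge1$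 the operator $W_n p=\bigl(n+\sum_{\alpha\in R_+}k(\alpha)\bigr)p-\sum_{\alpha\in R_+}k(\alpha)\,p\circ\sigma_\alpha$ is invertible on $\mathcal P_n$. Then there is a unique linear isomorphism $V_k$ of $\mathcal P$ (the intertwining operator) with $V_k(\mathcal P_n)\subset\mathcal P_n$ for all $n$, $V_k(1)=1$ and $T_\xi V_k=V_k\partial_\xi$ for all $\xi\in\mathbb{R}^d$. Put $E_n(x,y)=\frac1{n!}V_k(\langle\cdot,y\rangle^n)(x)$. The series $$L_k(x,y)=\sum_{n=0}^\infty\bigl(e^{-\Delta/2}E_n(x,\cdot)\bigr)(y),\qquad e^{-\Delta/2}=\sum_{m\ge0}\frac{(-1/2)^m}{m!}\Delta^m,$$ converges absolutely for all $x,y\in\mathbb{R}^d$, the kernel $L_k$ belongs to $C^\infty(\mathbb{R}^d\times\mathbb{R}^d)$, and for all $x,y\in\mathbb{R}^d$ and $j=1,\dots,d$ $$\partial_{y_j}\Bigl(L_k(x,\cdot)e^{-\|\cdot\|^2/2}\Bigr)(y)=-\,T_j\Bigl(L_k(\cdot,y)e^{-\|y\|^2/2}\Bigr)(x).$$ -/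

import Mathlib

open scoped InnerProductSpace ContDiff Laplacian

namespace Dunkl

noncomputable section

/-- `ℝ^d` with its Euclidean structure. -/
abbrev E (d : ℕ) : Type := EuclideanSpace ℝ (Fin d)

/-- The reflection `σ_α` in the hyperplane orthogonal to `α`. -/
abbrev refl {d : ℕ} (α : E d) : E d ≃ₗᵢ[ℝ] E d := (ℝ ∙ α)ᗮ.reflection

/-- The usual formula `σ_α x = x - 2 ⟨x, α⟩ α / ‖α‖²`. -/
theorem refl_apply {d : ℕ} (α x : E d) :
    refl α x = x - (2 * ⟪x, α⟫_ℝ / ‖α‖ ^ 2) • α := by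
  rw [Submodule.reflection_orthogonal_apply, Submodule.reflection_singleton_apply,
    real_inner_comm x α, two_smul, neg_sub, ← add_smul]
  congr 2
  simp only [RCLike.ofReal_real_eq_id, id_eq]
  ring

/-- A (not necessarily reduced, crystallographic or spanning) root system in `ℝ^d`:
a finite set of nonzero vectors which is stable under the reflections in its elements. -/
structure IsRootSystem {d : ℕ} (R : Finset (E d)) : Prop where
  zero_notMem : (0 : E d) ∉ R
  refl_mem : ∀ α ∈ R, ∀ β ∈ R, refl α β ∈ R

/-- The reflection group `G` generated by the `σ_α`, `α ∈ R`. -/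
def reflGroup {d : ℕ} (R : Finset (E d)) : Subgroup (E d ≃ₗᵢ[ℝ] E d) :=
  Subgroup.closure {g | ∃ α ∈ R, g = refl α}

/-- `k` is a parameter function: it is constant on the `G`-orbits in `R`. (Only the values of `k`
on `R` play a role.) -/
def IsParameter {d : ℕ} (R : Finset (E d)) (k : E d → ℂ) : Prop :=
  ∀ g ∈ reflGroup R, ∀ α ∈ R, k (g α) = k α

/-- `R_+ = {α ∈ R : ⟨α, β⟩ > 0}`. -/
def positiveRoots {d : ℕ} (R : Finset (E d)) (β : E d) : Finset (E d) :=
  R.filter fun α => 0 < ⟪α, β⟫_ℝ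

/-- The quotient `(f x - f (σ_α x)) / ⟨α, x⟩`, extended by continuity to the hyperplane
`⟨α, x⟩ = 0`: for `f` of class `C¹` the value of the extension at such a point is
`2 ∂_α f (x) / ‖α‖²`. -/
def differenceQuotient {d : ℕ} (α : E d) (f : E d → ℂ) (x : E d) : ℂ :=
  if ⟪α, x⟫_ℝ = 0 then ((2 / ‖α‖ ^ 2 : ℝ) : ℂ) * fderiv ℝ f x α
  else (f x - f (refl α x)) / ((⟪α, x⟫_ℝ : ℝ) : ℂ)

/-- The Dunkl operator `T_ξ(k)`, for the set `Rp` of positive roots. -/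
def dunklOp {d : ℕ} (Rp : Finset (E d)) (k : E d → ℂ) (ξ : E d) (f : E d → ℂ) (x : E d) : ℂ :=
  fderiv ℝ f x ξ + ∑ α ∈ Rp, k α * ((⟪α, ξ⟫_ℝ : ℝ) : ℂ) * differenceQuotient α f x

/-- The polynomial function on `ℝ^d` given by `p ∈ ℂ[X_1, …, X_d]`. -/
def polyFun {d : ℕ} (p : MvPolynomial (Fin d) ℂ) (x : E d) : ℂ :=
  MvPolynomial.eval (fun i => ((x i : ℝ) : ℂ)) p

/-- The set `𝒫_n` of homogeneous polynomial functions of degree `n` on `ℝ^d`. -/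
def homPoly (d n : ℕ) : Set (E d → ℂ) :=
  {f | ∃ p : MvPolynomial (Fin d) ℂ, p.IsHomogeneous n ∧ f = polyFun p}

/-- The operator `W_n = (n + γ) - A`, where `A f = ∑_{α ∈ R_+} k(α) f ∘ σ_α` and
`γ = ∑_{α ∈ R_+} k(α)`. -/
def eulerOp {d : ℕ} (Rp : Finset (E d)) (k : E d → ℂ) (n : ℕ) (f : E d → ℂ) (x : E d) : ℂ :=
  ((n : ℂ) + ∑ α ∈ Rp, k α) * f x - ∑ α ∈ Rp, k α * f (refl α x)

/-- The condition `k ∈ M^*`: for all `n ≥ 1`, `W_n` is invertible as an operator on `𝒫_n`. -/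
def MStar {d : ℕ} (Rp : Finset (E d)) (k : E d → ℂ) : Prop :=
  ∀ n : ℕ, 1 ≤ n → Set.BijOn (eulerOp Rp k n) (homPoly d n) (homPoly d n)

/-- `V` is an intertwining operator: a linear isomorphism of the space of polynomials with
`V 𝒫_n ⊆ 𝒫_n`, `V 1 = 1` and `T_ξ V = V ∂_ξ` for all `ξ`. -/
structure IsIntertwining {d : ℕ} (Rp : Finset (E d)) (k : E d → ℂ)
    (V : MvPolynomial (Fin d) ℂ ≃ₗ[ℂ] MvPolynomial (Fin d) ℂ) : Prop where
  map_homogeneous : ∀ (n : ℕ) (p : MvPolynomial (Fin d) ℂ),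
    p.IsHomogeneous n → (V p).IsHomogeneous n
  map_one : V 1 = 1
  intertwine : ∀ (ξ : E d) (p : MvPolynomial (Fin d) ℂ),
    dunklOp Rp k ξ (polyFun (V p)) =
      polyFun (V (∑ j, MvPolynomial.C ((ξ j : ℝ) : ℂ) * MvPolynomial.pderiv j p))

/-- The intertwining operator `V_k` (it exists and is unique for `k ∈ M^*`). -/
def intertwiningOp {d : ℕ} (Rp : Finset (E d)) (k : E d → ℂ) :
    MvPolynomial (Fin d) ℂ ≃ₗ[ℂ] MvPolynomial (Fin d) ℂ :=
  Classical.epsilon (IsIntertwining Rp k)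

/-- `E_n(x, y) = V_k(⟨·, y⟩ⁿ)(x) / n!`. -/
def kernelE {d : ℕ} (Rp : Finset (E d)) (k : E d → ℂ) (n : ℕ) (x y : E d) : ℂ :=
  (1 / (n.factorial : ℂ)) * polyFun (intertwiningOp Rp k
    ((∑ j, MvPolynomial.C ((y j : ℝ) : ℂ) * MvPolynomial.X j) ^ n)) x

/-- `e^{-Δ/2} f = ∑_m (-1/2)^m Δ^m f / m!` (for polynomial functions `f` a finite sum). -/
def expNegHalfLaplacian {d : ℕ} (f : E d → ℂ) (y : E d) : ℂ :=
  ∑' m : ℕ, ((-1 / 2 : ℂ) ^ m / (m.factorial : ℂ)) *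
    ((fun g : E d → ℂ => Laplacian.laplacian g)^[m] f) y

/-- The `n`-th term `(e^{-Δ/2} E_n(x, ·))(y)` of the series that defines `L_k(x, y)`. -/
def kernelLTerm {d : ℕ} (Rp : Finset (E d)) (k : E d → ℂ) (x y : E d) (n : ℕ) : ℂ :=
  expNegHalfLaplacian (fun z => kernelE Rp k n x z) y

/-- The kernel `L_k(x, y) = ∑_n (e^{-Δ/2} E_n(x, ·))(y)`. -/
def kernelL {d : ℕ} (Rp : Finset (E d)) (k : E d → ℂ) (x y : E d) : ℂ :=
  ∑' n : ℕ, kernelLTerm Rp k x y n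

end

end Dunkl

/-! The kernel is a transform of a Gaussian: L_k(x, y) = V_k(exp(-‖·‖²/2 + ⟨·, y⟩))(x), where V_k
acts term by term on the power series. Indeed Δ_y ⟨·, y⟩^n = n(n-1) ‖·‖² ⟨·, y⟩^(n-2), so e^{-Δ/2}
E_n(x, ·) collects the terms (-1/2)^m/(m! l!) V_k(‖·‖^(2m) ⟨·, y⟩^l)(x) with 2m + l = n
(`hasSum_kernelLTerm`). Write K(q) for the transform of q times this exponential. Differentiation in
y brings down ⟨ξ, ·⟩ (`fderiv_gaussKernel_right`), and T_ξ V_k = V_k ∂_ξ gives T_ξ K(1) = -K(⟨ξ, ·⟩)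
+ ⟨ξ, y⟩ K(1) (`dunklOp_gaussKernel`). The factor e^{-‖y‖²/2} absorbs the last term.

The intertwining operator is the inverse of a Taylor map q ↦ ∑_n (1/n!) (∑ X_j T_j)^n q(0), with the
n-th term applied to the part of q of degree n. The T_j commute (`dunklPoly_comm`), so ∂_j
corresponds to T_j. Since ∑ x_j T_j = W_n on 𝒫_n (`sum_X_mul_dunklPoly`), invertibility of W_n makes
a polynomial of positive degree killed by all T_j vanish; this gives injectivity of the Taylor map,
surjectivity by dimension, and uniqueness of V_k.

Convergence rests on a geometric bound for V_k on monomials (`IsIntertwining.exists_isoNorm_le`),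
obtained from the recursion W_n V_k p = ∑ x_j V_k ∂_j p: in an orthogonally invariant norm W_n is
bounded below by n/2 for large n, which compensates the factor n produced by the derivatives. The
factorials of the exponential then dominate on every ball, for all derivatives as well. -/

namespace Dunkl

noncomputable section

open MvPolynomial

variable {d : ℕ}

/-! ### Polynomial functions, linear forms and composition with isometries. -/

/-- Polynomials in `d` variables over `ℂ`. -/
abbrev Poly (d : ℕ) : Type := MvPolynomial (Fin d) ℂ

/-- Evaluation at a real point, as a ring homomorphism. -/
def evalAt (x : E d) : Poly d →+* ℂ := MvPolynomial.eval fun i => ((x i : ℝ) : ℂ)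

theorem polyFun_eq (p : Poly d) (x : E d) : polyFun p x = evalAt x p := rfl

@[simp] theorem evalAt_C (x : E d) (c : ℂ) : evalAt x (C c) = c := by simp [evalAt]

@[simp] theorem evalAt_X (x : E d) (i : Fin d) : evalAt x (X i) = ((x i : ℝ) : ℂ) := by
  simp [evalAt]

@[simp] theorem evalAt_smul (x : E d) (c : ℂ) (p : Poly d) : evalAt x (c • p) = c * evalAt x p := by
  simp [evalAt]

theorem poly_ext {p q : Poly d} (h : ∀ x : E d, evalAt x p = evalAt x q) : p = q := by
  refine MvPolynomial.funext_set (fun _ => Set.range ((↑) : ℝ → ℂ)) (fun _ =>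
    Set.infinite_range_of_injective Complex.ofReal_injective) fun z hz => ?_
  choose x hx using fun i => hz i (Set.mem_univ i)
  have := h (WithLp.toLp 2 x)
  simpa [evalAt, hx] using this

theorem polyFun_injective : Function.Injective (polyFun (d := d)) := fun _ _ h =>
  poly_ext fun x => congrFun h x

/-- The linear form `⟨α, ·⟩`. -/
def lin (α : E d) : Poly d := ∑ j, C ((α j : ℝ) : ℂ) * X j

@[simp] theorem evalAt_lin (α x : E d) : evalAt x (lin α) = ((⟪α, x⟫_ℝ : ℝ) : ℂ) := by
  simp [lin, PiLp.inner_apply, mul_comm]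

theorem lin_single (j : Fin d) : lin (EuclideanSpace.single j (1 : ℝ)) = X j := by
  apply poly_ext; intro x
  rw [evalAt_lin, EuclideanSpace.inner_single_left]; simp

theorem lin_isHomogeneous (α : E d) : (lin α).IsHomogeneous 1 :=
  IsHomogeneous.sum _ _ _ fun _ _ => isHomogeneous_C_mul_X _ _

theorem lin_ne_zero {α : E d} (h : α ≠ 0) : lin α ≠ 0 := by
  intro h0
  have := evalAt_lin α α
  rw [h0, map_zero, real_inner_self_eq_norm_sq] at this
  have h2 : ‖α‖ ^ 2 = 0 := by exact_mod_cast this.symm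
  exact h (by simpa using h2)

theorem lin_neg (α : E d) : lin (-α) = -lin α := by
  apply poly_ext; intro x; simp

/-- Composition of a polynomial with a linear isometry. -/
def act (g : E d ≃ₗᵢ[ℝ] E d) : Poly d →ₐ[ℂ] Poly d :=
  aeval fun i => lin (g.symm (EuclideanSpace.single i (1 : ℝ)))

@[simp] theorem evalAt_act (g : E d ≃ₗᵢ[ℝ] E d) (p : Poly d) (x : E d) :
    evalAt x (act g p) = evalAt (g x) p := by
  have : (evalAt x).comp (act g : Poly d →ₐ[ℂ] Poly d).toRingHom = evalAt (g x) := by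
    apply MvPolynomial.ringHom_ext
    · intro r; simp [act, evalAt]
    · intro i
      have h1 : ⟪g.symm (EuclideanSpace.single i (1 : ℝ)), x⟫_ℝ
          = ⟪EuclideanSpace.single i (1 : ℝ), g x⟫_ℝ := by
        rw [← g.inner_map_map, g.apply_symm_apply]
      simp only [act, AlgHom.toRingHom_eq_coe, RingHom.coe_comp, RingHom.coe_coe,
        Function.comp_apply, aeval_X, evalAt_lin, evalAt_X, h1, EuclideanSpace.inner_single_left]
      simp
  exact congrArg (fun f : Poly d →+* ℂ => f p) this

theorem act_lin (g : E d ≃ₗᵢ[ℝ] E d) (α : E d) : act g (lin α) = lin (g.symm α) := by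
  apply poly_ext; intro x
  rw [evalAt_act, evalAt_lin, evalAt_lin, ← g.inner_map_map (g.symm α), g.apply_symm_apply]

theorem act_act (g h : E d ≃ₗᵢ[ℝ] E d) (p : Poly d) : act g (act h p) = act (g.trans h) p := by
  apply poly_ext; intro x; simp

theorem act_isHomogeneous (g : E d ≃ₗᵢ[ℝ] E d) {p : Poly d} {n : ℕ} (h : p.IsHomogeneous n) :
    (act g p).IsHomogeneous n := by
  have := h.aeval (S := ℂ) (fun i => lin (g.symm (EuclideanSpace.single i (1 : ℝ))))
    fun i => lin_isHomogeneous _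
  simpa [act] using this

theorem refl_refl (α x : E d) : refl α (refl α x) = x :=
  Submodule.reflection_reflection _ _

@[simp] theorem refl_symm (α : E d) : (refl α).symm = refl α :=
  Submodule.reflection_symm

/-! ### Directional derivatives of polynomials. -/

/-- The directional derivative `∂_ξ`. -/
def dirD (ξ : E d) : Derivation ℂ (Poly d) (Poly d) :=
  mkDerivation ℂ fun j => C ((ξ j : ℝ) : ℂ)

theorem dirD_apply (ξ : E d) (p : Poly d) :
    dirD ξ p = ∑ j, C ((ξ j : ℝ) : ℂ) * pderiv j p := by
  induction p using MvPolynomial.induction_on with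
  | C c => simp [dirD]
  | add p q hp hq => simp [hp, hq, mul_add, Finset.sum_add_distrib]
  | mul_X p i hp =>
    rw [Derivation.leibniz, hp, dirD, mkDerivation_X]
    simp only [Derivation.leibniz, smul_eq_mul, mul_add, Finset.sum_add_distrib, pderiv_X,
      Pi.single_apply, mul_ite, mul_one, mul_zero, Finset.sum_ite_eq, Finset.mem_univ, if_true,
      Finset.mul_sum]
    congr 1
    · simp [mul_comm]
    · exact Finset.sum_congr rfl fun j _ => by ring

@[simp] theorem dirD_lin (ξ α : E d) : dirD ξ (lin α) = C ((⟪ξ, α⟫_ℝ : ℝ) : ℂ) := by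
  simp only [lin, map_sum, Derivation.leibniz, dirD, mkDerivation_X, derivation_C]
  simp [PiLp.inner_apply]

theorem dirD_isHomogeneous (ξ : E d) {p : Poly d} {n : ℕ} (h : p.IsHomogeneous n) :
    (dirD ξ p).IsHomogeneous (n - 1) := by
  rw [dirD_apply]
  exact IsHomogeneous.sum _ _ _ fun _ _ => h.pderiv.C_mul _

theorem act_dirD (g : E d ≃ₗᵢ[ℝ] E d) (ξ : E d) (p : Poly d) :
    act g (dirD ξ p) = dirD (g.symm ξ) (act g p) := by
  induction p using MvPolynomial.induction_on with
  | C c => simp [dirD, act]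
  | add p q hp hq => simp [hp, hq]
  | mul_X p i hp =>
    rw [← lin_single i, Derivation.leibniz, map_add, smul_eq_mul, smul_eq_mul, map_mul, map_mul,
      hp, map_mul, Derivation.leibniz, act_lin, dirD_lin, dirD_lin]
    simp only [LinearIsometryEquiv.inner_map_map, smul_eq_mul]
    simp [act]

theorem hasFDerivAt_polyFun (p : Poly d) (x : E d) :
    ∃ f' : E d →L[ℝ] ℂ, HasFDerivAt (polyFun p) f' x ∧ ∀ ξ, f' ξ = polyFun (dirD ξ p) x := by
  induction p using MvPolynomial.induction_on with
  | C c =>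
    refine ⟨0, ?_, fun ξ => ?_⟩
    · have : polyFun (C c : Poly d) = fun _ => c := by ext y; simp [polyFun]
      rw [this]; exact hasFDerivAt_const _ _
    · simp [polyFun, dirD]
  | add p q hp hq =>
    obtain ⟨f, hf, hf'⟩ := hp
    obtain ⟨g, hg, hg'⟩ := hq
    refine ⟨f + g, ?_, fun ξ => ?_⟩
    · have : polyFun (p + q) = fun y => polyFun p y + polyFun q y := by ext y; simp [polyFun]
      rw [this]; exact hf.add hg
    · simp [hf', hg', polyFun]
  | mul_X p i hp =>
    obtain ⟨f, hf, hf'⟩ := hp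
    have hX : HasFDerivAt (fun y : E d => ((y i : ℝ) : ℂ))
        (Complex.ofRealCLM.comp (EuclideanSpace.proj i : E d →L[ℝ] ℝ)) x :=
      (Complex.ofRealCLM.comp (EuclideanSpace.proj i : E d →L[ℝ] ℝ)).hasFDerivAt
    have h : HasFDerivAt (polyFun (p * X i)) _ x :=
      (hf.mul hX).congr_of_eventuallyEq (.of_forall fun y => by simp [polyFun])
    refine ⟨_, h, fun ξ => ?_⟩
    simp [hf', Derivation.leibniz, polyFun, dirD]

theorem fderiv_polyFun (p : Poly d) (x ξ : E d) :
    fderiv ℝ (polyFun p) x ξ = polyFun (dirD ξ p) x := by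
  obtain ⟨f, hf, hf'⟩ := hasFDerivAt_polyFun p x
  rw [hf.fderiv, hf']

/-! ### Divided differences. -/

/-- The twisted Leibniz rule pX - σ(pX) = (p - σp)X + σp(X - σX) reduces divisibility to
coordinates, where x - σ_α x is a multiple of α. -/
theorem lin_dvd_sub_act_refl (α : E d) (p : Poly d) : lin α ∣ p - act (refl α) p := by
  induction p using MvPolynomial.induction_on with
  | C c => simp [act]
  | add p q hp hq =>
    rw [map_add, add_sub_add_comm]; exact dvd_add hp hq
  | mul_X p i hp =>
    have h2 : lin α ∣ X i - act (refl α) (X i) := by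
      refine ⟨C ((2 * (α i) / ‖α‖ ^ 2 : ℝ) : ℂ), poly_ext fun x => ?_⟩
      simp only [map_sub, evalAt_act, evalAt_X, map_mul, evalAt_lin, evalAt_C, refl_apply]
      simp [real_inner_comm α x]
      ring
    have : p * X i - act (refl α) (p * X i)
        = (p - act (refl α) p) * X i + act (refl α) p * (X i - act (refl α) (X i)) := by
      rw [map_mul]; ring
    rw [this]
    exact dvd_add (hp.mul_right _) (h2.mul_left _)

theorem exists_divDiff (α : E d) :
    ∃ D : Poly d →ₗ[ℂ] Poly d, ∀ p, α ≠ 0 → lin α * D p = p - act (refl α) p := by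
  by_cases h : α = 0
  · exact ⟨0, fun p h' => absurd h h'⟩
  · choose D hD using lin_dvd_sub_act_refl α
    refine ⟨⟨⟨D, fun p q => ?_⟩, fun c p => ?_⟩, fun p _ => (hD p).symm⟩
    · apply mul_left_cancel₀ (lin_ne_zero h)
      rw [mul_add, ← hD, ← hD, ← hD, map_add]; ring
    · apply mul_left_cancel₀ (lin_ne_zero h)
      rw [RingHom.id_apply, mul_smul_comm, ← hD, ← hD, map_smul, smul_sub]

/-- The divided difference `p ↦ (p - p ∘ σ_α) / ⟨α, ·⟩` on polynomials. -/
def divDiff (α : E d) : Poly d →ₗ[ℂ] Poly d := (exists_divDiff α).choose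

theorem lin_mul_divDiff {α : E d} (h : α ≠ 0) (p : Poly d) :
    lin α * divDiff α p = p - act (refl α) p :=
  (exists_divDiff α).choose_spec p h

theorem divDiff_eq_of_mul {α : E d} (h : α ≠ 0) {p q : Poly d}
    (hq : lin α * q = p - act (refl α) p) : divDiff α p = q :=
  mul_left_cancel₀ (lin_ne_zero h) ((lin_mul_divDiff h p).trans hq.symm)

theorem polyFun_divDiff {α : E d} (h : α ≠ 0) (p : Poly d) (x : E d) :
    polyFun (divDiff α p) x = differenceQuotient α (polyFun p) x := by
  have hn : (‖α‖ : ℂ) ^ 2 ≠ 0 := by simpa using h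
  unfold differenceQuotient
  split_ifs with hx
  · rw [fderiv_polyFun, polyFun_eq, polyFun_eq]
    -- On the hyperplane, differentiate ⟨α, ·⟩ D p = p - p ∘ σ_α along α. As σ_α fixes x and
    -- reverses α, this gives ‖α‖² D p(x) = 2 ∂_α p(x).
    have h1 := congrArg (fun q => evalAt x (dirD α q)) (lin_mul_divDiff h p)
    have h3 : refl α x = x := by rw [refl_apply, real_inner_comm, hx]; simp
    have h5 : dirD (refl α α) (act (refl α) p) = act (refl α) (dirD α p) := by
      rw [act_dirD, refl_symm]
    have h6 : refl α α = -α := by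
      rw [refl_apply, real_inner_self_eq_norm_sq, mul_div_assoc, div_self (by simpa using h)]
      module
    have h7 : dirD (-α) (act (refl α) p) = - dirD α (act (refl α) p) := by
      rw [dirD_apply, dirD_apply]; simp
    have h8 : evalAt x (dirD α (act (refl α) p)) = - evalAt x (dirD α p) := by
      have := congrArg (evalAt x) h5
      rw [h6, h7, evalAt_act, h3, map_neg] at this
      rw [← this, neg_neg]
    simp only [Derivation.leibniz, smul_eq_mul, map_add, map_mul, evalAt_lin, hx, dirD_lin,
      evalAt_C, real_inner_self_eq_norm_sq, map_sub, h8] at h1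
    push_cast at h1 ⊢
    rw [div_mul_eq_mul_div, eq_div_iff hn]
    linear_combination h1
  · have hx' : ((⟪α, x⟫_ℝ : ℝ) : ℂ) ≠ 0 := by exact_mod_cast hx
    rw [eq_div_iff hx', polyFun_eq, polyFun_eq, polyFun_eq]
    have h1 := congrArg (evalAt x) (lin_mul_divDiff h p)
    simp only [map_mul, evalAt_lin, map_sub, evalAt_act] at h1
    rw [mul_comm, h1]

theorem homogeneousComponent_mul_of_isHomogeneous {l : Poly d} {m : ℕ} (hl : l.IsHomogeneous m)
    (q : Poly d) (i : ℕ) :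
    homogeneousComponent (m + i) (l * q) = l * homogeneousComponent i q := by
  conv_lhs => rw [← sum_homogeneousComponent q, Finset.mul_sum, map_sum]
  have h1 : ∀ j, homogeneousComponent (m + i) (l * homogeneousComponent j q)
      = if m + i = m + j then l * homogeneousComponent j q else 0 := fun j =>
    homogeneousComponent_of_mem (hl.mul (homogeneousComponent_isHomogeneous j q))
  simp only [h1, add_right_inj, Finset.sum_ite_eq, Finset.mem_range, Nat.lt_succ_iff]
  split_ifs with h
  · rfl
  · rw [homogeneousComponent_eq_zero _ _ (not_le.mp h), mul_zero]

theorem divDiff_isHomogeneous {α : E d} (h : α ≠ 0) {p : Poly d} {n : ℕ} (hp : p.IsHomogeneous n) :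
    (divDiff α p).IsHomogeneous (n - 1) := by
  have hr : (lin α * divDiff α p).IsHomogeneous n := by
    rw [lin_mul_divDiff h]; exact hp.sub (act_isHomogeneous _ hp)
  -- Multiplication by the linear form shifts degrees by one and is injective. For n = 0 every
  -- component vanishes, so the truncated degree n - 1 is harmless.
  have key : ∀ i, 1 + i ≠ n → homogeneousComponent i (divDiff α p) = 0 := by
    intro i hi
    apply mul_left_cancel₀ (lin_ne_zero h)
    rw [← homogeneousComponent_mul_of_isHomogeneous (lin_isHomogeneous α), mul_zero,
      homogeneousComponent_of_mem hr, if_neg hi]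
  rw [← sum_homogeneousComponent (divDiff α p)]
  refine IsHomogeneous.sum _ _ _ fun i _ => ?_
  by_cases hi : 1 + i = n
  · have : i = n - 1 := by omega
    subst this; exact homogeneousComponent_isHomogeneous _ _
  · rw [key i hi]; exact isHomogeneous_zero _ _ _

theorem divDiff_C {α : E d} (h : α ≠ 0) (c : ℂ) : divDiff α (C c) = 0 :=
  divDiff_eq_of_mul h (by simp [act])

theorem divDiff_lin_mul {α : E d} (h : α ≠ 0) (ζ : E d) (p : Poly d) :
    divDiff α (lin ζ * p) = lin ζ * divDiff α p
      + ((2 * ⟪α, ζ⟫_ℝ / ‖α‖ ^ 2 : ℝ) : ℂ) • act (refl α) p := by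
  apply divDiff_eq_of_mul h
  have h1 := lin_mul_divDiff h p
  have h2 : lin ζ - lin (refl α ζ) = C ((2 * ⟪α, ζ⟫_ℝ / ‖α‖ ^ 2 : ℝ) : ℂ) * lin α := by
    apply poly_ext; intro x
    simp only [map_sub, evalAt_lin, refl_apply, map_mul, evalAt_C, inner_sub_left, inner_smul_left]
    simp [real_inner_comm]
  rw [map_mul, act_lin, refl_symm, smul_eq_C_mul]
  linear_combination lin ζ * h1 - act (refl α) p * h2

theorem act_divDiff (g : E d ≃ₗᵢ[ℝ] E d) {α : E d} (h : α ≠ 0) (p : Poly d) :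
    act g (divDiff α p) = divDiff (g.symm α) (act g p) := by
  have h0 : g.symm α ≠ 0 := fun h' => h (by simpa using h')
  refine (divDiff_eq_of_mul h0 ?_).symm
  have h1 : act (refl (g.symm α)) (act g p) = act g (act (refl α) p) := by
    apply poly_ext; intro x
    have h2 : g (refl (g.symm α) x) = refl α (g x) := by
      rw [refl_apply, refl_apply, map_sub, map_smul, g.apply_symm_apply,
        LinearIsometryEquiv.norm_map, ← g.inner_map_map x, g.apply_symm_apply]
    simp only [evalAt_act, h2]
  rw [← act_lin, ← map_mul, lin_mul_divDiff h, map_sub, h1]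

theorem divDiff_neg {α : E d} (h : α ≠ 0) (p : Poly d) : divDiff (-α) p = - divDiff α p := by
  apply divDiff_eq_of_mul (neg_ne_zero.mpr h)
  have : act (refl (-α)) p = act (refl α) p := by
    apply poly_ext; intro x
    have h2 : refl (-α) x = refl α x := by
      rw [refl_apply, refl_apply, inner_neg_right, norm_neg]; module
    rw [evalAt_act, evalAt_act, h2]
  rw [lin_neg, neg_mul_neg, lin_mul_divDiff h, this]

/-! ### Dunkl operators on polynomials and the Euler identity. -/

/-- The Dunkl operator on polynomials. -/
def dunklPoly (S : Finset (E d)) (k : E d → ℂ) (ξ : E d) : Poly d →ₗ[ℂ] Poly d :=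
  (dirD ξ : Poly d →ₗ[ℂ] Poly d) + ∑ α ∈ S, (k α * ((⟪α, ξ⟫_ℝ : ℝ) : ℂ)) • divDiff α

theorem dunklPoly_apply (S : Finset (E d)) (k : E d → ℂ) (ξ : E d) (p : Poly d) :
    dunklPoly S k ξ p = dirD ξ p + ∑ α ∈ S, (k α * ((⟪α, ξ⟫_ℝ : ℝ) : ℂ)) • divDiff α p := by
  simp [dunklPoly]

theorem dunklOp_polyFun {S : Finset (E d)} (hS : (0 : E d) ∉ S) (k : E d → ℂ) (ξ : E d)
    (p : Poly d) : dunklOp S k ξ (polyFun p) = polyFun (dunklPoly S k ξ p) := by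
  ext x
  rw [dunklOp, fderiv_polyFun, dunklPoly_apply, polyFun_eq, polyFun_eq, map_add, map_sum]
  congr 1
  refine Finset.sum_congr rfl fun α hα => ?_
  rw [evalAt_smul, ← polyFun_divDiff (fun h => hS (h ▸ hα)), polyFun_eq]

theorem dunklPoly_C {S : Finset (E d)} (hS : (0 : E d) ∉ S) (k : E d → ℂ) (ξ : E d) (c : ℂ) :
    dunklPoly S k ξ (C c) = 0 := by
  rw [dunklPoly_apply, dirD, derivation_C, zero_add]
  exact Finset.sum_eq_zero fun α hα => by rw [divDiff_C (fun h => hS (h ▸ hα)), smul_zero]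

theorem dunklPoly_isHomogeneous {S : Finset (E d)} (hS : (0 : E d) ∉ S) (k : E d → ℂ) (ξ : E d)
    {p : Poly d} {n : ℕ} (hp : p.IsHomogeneous n) : (dunklPoly S k ξ p).IsHomogeneous (n - 1) := by
  rw [dunklPoly_apply]
  refine (dirD_isHomogeneous ξ hp).add (IsHomogeneous.sum _ _ _ fun α hα => ?_)
  rw [smul_eq_C_mul]
  exact (divDiff_isHomogeneous (fun h => hS (h ▸ hα)) hp).C_mul _

/-- `p ↦ (n + γ) p - ∑ k(α) p ∘ σ_α` on polynomials. -/
def eulerPoly (S : Finset (E d)) (k : E d → ℂ) (n : ℕ) (p : Poly d) : Poly d :=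
  ((n : ℂ) + ∑ α ∈ S, k α) • p - ∑ α ∈ S, k α • act (refl α) p

theorem polyFun_eulerPoly (S : Finset (E d)) (k : E d → ℂ) (n : ℕ) (p : Poly d) :
    polyFun (eulerPoly S k n p) = eulerOp S k n (polyFun p) := by
  ext x
  simp [eulerPoly, eulerOp, polyFun_eq]

/-- Euler's formula handles the derivatives; in the difference part ∑ x_j ⟨α, e_j⟩ = ⟨α, x⟩ cancels
the denominator. This is how the hypothesis on W_n enters. -/
theorem sum_X_mul_dunklPoly {S : Finset (E d)} (hS : (0 : E d) ∉ S) (k : E d → ℂ)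
    {p : Poly d} {n : ℕ} (hp : p.IsHomogeneous n) :
    ∑ j, X j * dunklPoly S k (EuclideanSpace.single j 1) p = eulerPoly S k n p := by
  have h1 : ∀ j, dirD (EuclideanSpace.single j (1 : ℝ)) p = pderiv j p := fun j => by
    rw [dirD_apply, Finset.sum_eq_single j (fun i _ hi => by simp [hi]) (by simp)]
    simp
  have h2 : ∑ j, X j * pderiv j p = (n : ℂ) • p := by
    rw [hp.sum_X_mul_pderiv, Nat.cast_smul_eq_nsmul]
  have h3 : ∀ α ∈ S, ∑ j, X j * ((k α * ((⟪α, EuclideanSpace.single j (1 : ℝ)⟫_ℝ : ℝ) : ℂ)) •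
      divDiff α p) = k α • p - k α • act (refl α) p := fun α hα => by
    rw [← smul_sub, ← lin_mul_divDiff (fun h => hS (h ▸ hα)), lin, Finset.sum_mul, Finset.smul_sum]
    refine Finset.sum_congr rfl fun j _ => ?_
    rw [EuclideanSpace.inner_single_right]
    simp only [smul_eq_C_mul, map_mul, one_mul]
    simp
    ring
  simp only [dunklPoly_apply, mul_add, Finset.sum_add_distrib, h1, h2, Finset.mul_sum]
  rw [Finset.sum_comm, Finset.sum_congr rfl h3, Finset.sum_sub_distrib, ← Finset.sum_smul,
    eulerPoly, add_smul]
  abel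

/-- The injectivity of `W_n` on homogeneous polynomials of degree `n ≥ 1`. -/
def EulerInjective (S : Finset (E d)) (k : E d → ℂ) : Prop :=
  ∀ (n : ℕ) (p : Poly d), 1 ≤ n → p.IsHomogeneous n → eulerPoly S k n p = 0 → p = 0

theorem MStar.eulerInjective {S : Finset (E d)} {k : E d → ℂ} (h : MStar S k) :
    EulerInjective S k := by
  intro n p hn hp h0
  apply polyFun_injective
  refine (h n hn).injOn ⟨p, hp, rfl⟩ ⟨0, isHomogeneous_zero _ _ _, rfl⟩ ?_
  rw [← polyFun_eulerPoly, ← polyFun_eulerPoly, h0]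
  simp [eulerPoly]

theorem EulerInjective.eq_zero_of_dunklPoly {S : Finset (E d)} {k : E d → ℂ}
    (h : EulerInjective S k) (hS : (0 : E d) ∉ S) {n : ℕ} {p : Poly d} (hn : 1 ≤ n)
    (hp : p.IsHomogeneous n) (h0 : ∀ j, dunklPoly S k (EuclideanSpace.single j 1) p = 0) :
    p = 0 := by
  apply h n p hn hp
  rw [← sum_X_mul_dunklPoly hS k hp]
  simp [h0]

/-! ### Commutativity of the Dunkl operators. -/

section Commute

variable {S : Finset (E d)} {k : E d → ℂ}

theorem dunklPoly_lin_mul (hS : (0 : E d) ∉ S) (k : E d → ℂ) (ξ ζ : E d) (p : Poly d) :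
    dunklPoly S k ξ (lin ζ * p) = lin ζ * dunklPoly S k ξ p + ((⟪ξ, ζ⟫_ℝ : ℝ) : ℂ) • p
      + ∑ α ∈ S, (k α * ((2 * ⟪α, ξ⟫_ℝ * ⟪α, ζ⟫_ℝ / ‖α‖ ^ 2 : ℝ) : ℂ)) • act (refl α) p := by
  have h3 : ∀ α ∈ S, (k α * ((⟪α, ξ⟫_ℝ : ℝ) : ℂ)) • divDiff α (lin ζ * p)
      = lin ζ * ((k α * ((⟪α, ξ⟫_ℝ : ℝ) : ℂ)) • divDiff α p)
        + (k α * ((2 * ⟪α, ξ⟫_ℝ * ⟪α, ζ⟫_ℝ / ‖α‖ ^ 2 : ℝ) : ℂ)) • act (refl α) p := fun α hα => by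
    rw [divDiff_lin_mul (fun h => hS (h ▸ hα)), smul_add, mul_smul_comm, smul_smul]
    congr 2
    push_cast; ring
  rw [dunklPoly_apply, dunklPoly_apply, Finset.sum_congr rfl h3, Finset.sum_add_distrib,
    ← Finset.mul_sum, Derivation.leibniz, dirD_lin, smul_eq_mul, smul_eq_mul, smul_eq_C_mul]
  ring

theorem dunklPoly_add_dir (ξ η : E d) (p : Poly d) :
    dunklPoly S k (ξ + η) p = dunklPoly S k ξ p + dunklPoly S k η p := by
  simp only [dunklPoly_apply, dirD_apply, inner_add_right, Complex.ofReal_add, mul_add, add_smul,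
    Finset.sum_add_distrib, PiLp.add_apply, map_add, add_mul]
  abel

theorem dunklPoly_smul_dir (c : ℝ) (ξ : E d) (p : Poly d) :
    dunklPoly S k (c • ξ) p = (c : ℂ) • dunklPoly S k ξ p := by
  simp only [dunklPoly_apply, dirD_apply, inner_smul_right, smul_add, Finset.smul_sum]
  congr 1
  · refine Finset.sum_congr rfl fun j _ => ?_
    simp [smul_eq_C_mul, mul_assoc]
  · refine Finset.sum_congr rfl fun α _ => ?_
    rw [smul_smul]; congr 1; push_cast; ring

/-- Equivariance of the Dunkl operators under the reflections in the roots. -/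
def Equivariant (S : Finset (E d)) (k : E d → ℂ) : Prop :=
  ∀ γ ∈ S, ∀ (ξ : E d) (p : Poly d),
    act (refl γ) (dunklPoly S k ξ p) = dunklPoly S k (refl γ ξ) (act (refl γ) p)

/-- Equivariance replaces ξ by its reflection, and the two directions differ by a multiple of γ. -/
theorem dunklPoly_act_refl (hE : Equivariant S k) {γ : E d} (hγ : γ ∈ S) (ξ : E d)
    (p : Poly d) : dunklPoly S k ξ (act (refl γ) p) = act (refl γ) (dunklPoly S k ξ p)
      + ((2 * ⟪γ, ξ⟫_ℝ / ‖γ‖ ^ 2 : ℝ) : ℂ) • dunklPoly S k γ (act (refl γ) p) := by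
  have h1 : ξ = refl γ ξ + (2 * ⟪γ, ξ⟫_ℝ / ‖γ‖ ^ 2) • γ := by
    rw [refl_apply, real_inner_comm]; module
  rw [hE γ hγ, ← dunklPoly_smul_dir, ← dunklPoly_add_dir, ← h1]

/-- Every term of T_ξ T_η (⟨ζ, ·⟩ p) other than ⟨ζ, ·⟩ T_ξ T_η p is part of an expression symmetric
in ξ and η. The commutator is therefore linear over polynomials, and it kills constants. -/
theorem dunklPoly_commutator_lin_mul (hS : (0 : E d) ∉ S) (hE : Equivariant S k) (ξ η ζ : E d)
    (p : Poly d) :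
    dunklPoly S k ξ (dunklPoly S k η (lin ζ * p)) - dunklPoly S k η (dunklPoly S k ξ (lin ζ * p))
      = lin ζ * (dunklPoly S k ξ (dunklPoly S k η p) - dunklPoly S k η (dunklPoly S k ξ p)) := by
  have key : ∀ ξ η : E d, dunklPoly S k ξ (dunklPoly S k η (lin ζ * p))
      = lin ζ * dunklPoly S k ξ (dunklPoly S k η p) + ((⟪ξ, ζ⟫_ℝ : ℝ) : ℂ) • dunklPoly S k η p
        + ((⟪η, ζ⟫_ℝ : ℝ) : ℂ) • dunklPoly S k ξ p
        + ∑ α ∈ S, (k α * ((2 * ⟪α, ξ⟫_ℝ * ⟪α, ζ⟫_ℝ / ‖α‖ ^ 2 : ℝ) : ℂ)) •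
            act (refl α) (dunklPoly S k η p)
        + ∑ α ∈ S, (k α * ((2 * ⟪α, η⟫_ℝ * ⟪α, ζ⟫_ℝ / ‖α‖ ^ 2 : ℝ) : ℂ)) •
            act (refl α) (dunklPoly S k ξ p)
        + ∑ α ∈ S, (k α * ((4 * ⟪α, ξ⟫_ℝ * ⟪α, η⟫_ℝ * ⟪α, ζ⟫_ℝ / ‖α‖ ^ 4 : ℝ) : ℂ)) •
            dunklPoly S k α (act (refl α) p) := by
    intro ξ η
    have h3 : ∀ α ∈ S, dunklPoly S k ξ ((k α * ((2 * ⟪α, η⟫_ℝ * ⟪α, ζ⟫_ℝ / ‖α‖ ^ 2 : ℝ) : ℂ)) •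
        act (refl α) p) = (k α * ((2 * ⟪α, η⟫_ℝ * ⟪α, ζ⟫_ℝ / ‖α‖ ^ 2 : ℝ) : ℂ)) •
          act (refl α) (dunklPoly S k ξ p)
        + (k α * ((4 * ⟪α, ξ⟫_ℝ * ⟪α, η⟫_ℝ * ⟪α, ζ⟫_ℝ / ‖α‖ ^ 4 : ℝ) : ℂ)) •
            dunklPoly S k α (act (refl α) p) := fun α hα => by
      rw [map_smul, dunklPoly_act_refl hE hα, smul_add, smul_smul]
      congr 2
      push_cast; ring
    rw [dunklPoly_lin_mul hS, map_add, map_add, map_sum, Finset.sum_congr rfl h3,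
      Finset.sum_add_distrib, dunklPoly_lin_mul hS, map_smul]
    abel
  have h4 : ∑ α ∈ S, (k α * ((4 * ⟪α, ξ⟫_ℝ * ⟪α, η⟫_ℝ * ⟪α, ζ⟫_ℝ / ‖α‖ ^ 4 : ℝ) : ℂ)) •
            dunklPoly S k α (act (refl α) p)
      = ∑ α ∈ S, (k α * ((4 * ⟪α, η⟫_ℝ * ⟪α, ξ⟫_ℝ * ⟪α, ζ⟫_ℝ / ‖α‖ ^ 4 : ℝ) : ℂ)) •
            dunklPoly S k α (act (refl α) p) :=
    Finset.sum_congr rfl fun α _ => by congr 4; ring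
  rw [key ξ η, key η ξ, h4]
  ring

theorem dunklPoly_comm (hS : (0 : E d) ∉ S) (hE : Equivariant S k) (ξ η : E d) (p : Poly d) :
    dunklPoly S k ξ (dunklPoly S k η p) = dunklPoly S k η (dunklPoly S k ξ p) := by
  rw [← sub_eq_zero]
  induction p using MvPolynomial.induction_on with
  | C c => simp [dunklPoly_C hS]
  | add p q hp hq =>
    simp only [map_add, add_sub_add_comm, hp, hq, add_zero]
  | mul_X p i hp =>
    rw [mul_comm, ← lin_single, dunklPoly_commutator_lin_mul hS hE, hp, mul_zero]

end Commute

/-! ### Equivariance for the positive roots of a root system. -/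

section Positive

variable {R : Finset (E d)} {β : E d} {k : E d → ℂ}

theorem zero_notMem_positiveRoots (R : Finset (E d)) (β : E d) :
    (0 : E d) ∉ positiveRoots R β := by simp [positiveRoots]

theorem refl_self {α : E d} (h : α ≠ 0) : refl α α = -α := by
  rw [refl_apply, real_inner_self_eq_norm_sq, mul_div_assoc, div_self (by simpa using h)]
  module

theorem IsRootSystem.neg_mem (hR : IsRootSystem R) {α : E d} (h : α ∈ R) : -α ∈ R := by
  rw [← refl_self (fun h0 => hR.zero_notMem (h0 ▸ h))]
  exact hR.refl_mem α h α h

theorem IsParameter.refl (hk : IsParameter R k) {γ α : E d} (hγ : γ ∈ R) (hα : α ∈ R) :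
    k (refl γ α) = k α :=
  hk _ (Subgroup.subset_closure ⟨γ, hγ, rfl⟩) α hα

theorem IsParameter.neg (hR : IsRootSystem R) (hk : IsParameter R k) {α : E d} (hα : α ∈ R) :
    k (-α) = k α := by
  rw [← refl_self (fun h0 => hR.zero_notMem (h0 ▸ hα))]
  exact hk.refl hα hα

/-- A reflection need not preserve R_+, but it permutes R; doubling the sum moves the computation to
R. -/
theorem two_smul_sum_positiveRoots (hR : IsRootSystem R) (hβ : ∀ α ∈ R, ⟪α, β⟫_ℝ ≠ 0)
    {A : Type*} [AddCommGroup A] [Module ℂ A] (f : E d → A) (hf : ∀ α ∈ R, f (-α) = f α) :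
    (2 : ℂ) • ∑ α ∈ positiveRoots R β, f α = ∑ α ∈ R, f α := by
  rw [← Finset.sum_filter_add_sum_filter_not R (fun α => 0 < ⟪α, β⟫_ℝ) f, two_smul, positiveRoots]
  congr 1
  refine Finset.sum_bij' (fun α _ => -α) (fun α _ => -α) ?_ ?_ ?_ ?_ ?_
  · intro α hα
    simp only [Finset.mem_filter, inner_neg_left] at hα ⊢
    exact ⟨hR.neg_mem hα.1, by linarith [hα.2]⟩
  · intro α hα
    simp only [Finset.mem_filter, inner_neg_left, not_lt] at hα ⊢
    exact ⟨hR.neg_mem hα.1, by linarith [lt_of_le_of_ne hα.2 (hβ α hα.1)]⟩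
  · intro α _; simp
  · intro α _; simp
  · intro α hα
    exact (hf α (Finset.mem_filter.mp hα).1).symm

theorem equivariant_positiveRoots (hR : IsRootSystem R) (hβ : ∀ α ∈ R, ⟪α, β⟫_ℝ ≠ 0)
    (hk : IsParameter R k) : Equivariant (positiveRoots R β) k := by
  intro γ hγ ξ p
  have hγR : γ ∈ R := (Finset.mem_filter.mp hγ).1
  have h0 : ∀ α ∈ R, α ≠ 0 := fun α hα h => hR.zero_notMem (h ▸ hα)
  have key : ∀ (ξ : E d) (p : Poly d), (2 : ℂ) • ∑ α ∈ positiveRoots R β,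
      (k α * ((⟪α, ξ⟫_ℝ : ℝ) : ℂ)) • divDiff α p
        = ∑ α ∈ R, (k α * ((⟪α, ξ⟫_ℝ : ℝ) : ℂ)) • divDiff α p := fun ξ p =>
    two_smul_sum_positiveRoots hR hβ _ fun α hα => by
      rw [divDiff_neg (h0 α hα), hk.neg hR hα, inner_neg_left]
      simp
  have h2 : (2 : ℂ) ≠ 0 := two_ne_zero
  rw [dunklPoly_apply, dunklPoly_apply, map_add, act_dirD, refl_symm]
  congr 1
  refine smul_right_injective _ h2 ?_
  simp only
  rw [key, ← map_smul, key, map_sum]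
  refine Finset.sum_bij' (fun α _ => refl γ α) (fun α _ => refl γ α)
    (fun α hα => hR.refl_mem γ hγR α hα) (fun α hα => hR.refl_mem γ hγR α hα)
    (fun α _ => refl_refl γ α) (fun α _ => refl_refl γ α) fun α hα => ?_
  rw [map_smul, act_divDiff _ (h0 α hα), refl_symm, hk.refl hγR hα,
    LinearIsometryEquiv.inner_map_map]

end Positive

/-! ### Existence and uniqueness of the intertwining operator. -/

/-- The degree `n` part of the inverse of the intertwining operator:
`q ↦ (1/n!) (∑ X_j T_j)^n q (0)`, where the `T_j` act on `q` only. -/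
def taylorOp (S : Finset (E d)) (k : E d → ℂ) : ℕ → Poly d →ₗ[ℂ] Poly d
  | 0 => (Algebra.linearMap ℂ (Poly d)).comp (lcoeff ℂ 0)
  | n + 1 => ((n : ℂ) + 1)⁻¹ • ∑ j, (LinearMap.mulLeft ℂ (X j)).comp
      ((taylorOp S k n).comp (dunklPoly S k (EuclideanSpace.single j 1)))

theorem taylorOp_zero (S : Finset (E d)) (k : E d → ℂ) (p : Poly d) :
    taylorOp S k 0 p = C (coeff 0 p) := rfl

theorem taylorOp_succ (S : Finset (E d)) (k : E d → ℂ) (n : ℕ) (p : Poly d) :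
    taylorOp S k (n + 1) p = ((n : ℂ) + 1)⁻¹ •
      ∑ j, X j * taylorOp S k n (dunklPoly S k (EuclideanSpace.single j 1) p) := by
  simp [taylorOp]

theorem taylorOp_isHomogeneous (S : Finset (E d)) (k : E d → ℂ) (n : ℕ) (p : Poly d) :
    (taylorOp S k n p).IsHomogeneous n := by
  induction n generalizing p with
  | zero => rw [taylorOp_zero]; exact isHomogeneous_C _ _
  | succ n ih =>
    rw [taylorOp_succ, smul_eq_C_mul]
    refine (IsHomogeneous.sum _ _ _ fun j _ => ?_).C_mul _
    rw [add_comm]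
    exact (isHomogeneous_X _ _).mul (ih _)

variable {S : Finset (E d)} {k : E d → ℂ}

/-- Because the T_j commute, (∑ X_j T_j)^(n+1)/(n+1)! differentiates like a divided power. In the
induction the Leibniz rule yields n + 1 copies of the right side from the inner factor and one from
X_i. -/
theorem pderiv_taylorOp (hS : (0 : E d) ∉ S) (hE : Equivariant S k) (n : ℕ) (i : Fin d)
    (p : Poly d) : pderiv i (taylorOp S k (n + 1) p)
      = taylorOp S k n (dunklPoly S k (EuclideanSpace.single i 1) p) := by
  induction n generalizing p with
  | zero =>
    simp [taylorOp_succ, taylorOp_zero, Derivation.leibniz, pderiv_X, Pi.single_apply]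
  | succ n ih =>
    have hn : ((n + 1 : ℕ) : ℂ) + 1 ≠ 0 := by exact_mod_cast Nat.succ_ne_zero (n + 1)
    have hn' : (n : ℂ) + 1 ≠ 0 := by exact_mod_cast Nat.succ_ne_zero n
    rw [taylorOp_succ, Derivation.map_smul, inv_smul_eq_iff₀ hn, map_sum]
    have h1 : ∀ j, pderiv i (X j * taylorOp S k (n + 1)
        (dunklPoly S k (EuclideanSpace.single j 1) p)) =
        X j * taylorOp S k n (dunklPoly S k (EuclideanSpace.single j 1)
          (dunklPoly S k (EuclideanSpace.single i 1) p))
        + if i = j then taylorOp S k (n + 1) (dunklPoly S k (EuclideanSpace.single j 1) p)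
          else 0 := fun j => by
      rw [Derivation.leibniz, ih, dunklPoly_comm hS hE, pderiv_X, Pi.single_apply, smul_eq_mul,
        smul_eq_mul]
      simp [eq_comm]
    rw [Finset.sum_congr rfl fun j _ => h1 j, Finset.sum_add_distrib, Finset.sum_ite_eq,
      if_pos (Finset.mem_univ i), ← smul_inv_smul₀ hn' (∑ j, X j * taylorOp S k n _),
      ← taylorOp_succ, Nat.cast_succ,
      add_smul _ (1 : ℂ), one_smul]
    module

theorem taylorOp_injective (hS : (0 : E d) ∉ S) (hE : Equivariant S k) (hW : EulerInjective S k)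
    (n : ℕ) {p : Poly d} (hp : p.IsHomogeneous n) (h0 : taylorOp S k n p = 0) : p = 0 := by
  induction n generalizing p with
  | zero =>
    rw [taylorOp_zero] at h0
    rw [← totalDegree_zero_iff_isHomogeneous, totalDegree_eq_zero_iff_eq_C] at hp
    rw [hp, h0]
  | succ n ih =>
    refine hW.eq_zero_of_dunklPoly hS (Nat.succ_pos n) hp fun j => ih ?_ ?_
    · exact dunklPoly_isHomogeneous hS k _ hp
    · rw [← pderiv_taylorOp hS hE, h0, map_zero]

/-- The inverse of the intertwining operator. -/
def taylorMap (S : Finset (E d)) (k : E d → ℂ) : Poly d →ₗ[ℂ] Poly d :=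
  (basisMonomials (Fin d) ℂ).constr ℂ fun ν => taylorOp S k ν.degree (monomial ν 1)

theorem map_eq_sum_monomial (f : Poly d →ₗ[ℂ] Poly d) (p : Poly d) :
    f p = ∑ ν ∈ p.support, coeff ν p • f (monomial ν 1) := by
  conv_lhs => rw [p.as_sum, map_sum]
  refine Finset.sum_congr rfl fun ν _ => ?_
  rw [← map_smul, smul_monomial, smul_eq_mul, mul_one]

theorem taylorMap_monomial (S : Finset (E d)) (k : E d → ℂ) (ν : Fin d →₀ ℕ) :
    taylorMap S k (monomial ν 1) = taylorOp S k ν.degree (monomial ν 1) := by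
  have h : basisMonomials (Fin d) ℂ ν = monomial ν 1 := by rw [coe_basisMonomials]
  rw [taylorMap, ← h, Module.Basis.constr_basis, h]

theorem taylorMap_of_isHomogeneous (S : Finset (E d)) (k : E d → ℂ) {n : ℕ} {p : Poly d}
    (hp : p.IsHomogeneous n) : taylorMap S k p = taylorOp S k n p := by
  rw [map_eq_sum_monomial, map_eq_sum_monomial (taylorOp S k n)]
  refine Finset.sum_congr rfl fun ν hν => ?_
  have : ν.degree = n := by
    by_contra h
    exact mem_support_iff.mp hν (hp.coeff_eq_zero h)
  rw [taylorMap_monomial, this]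

theorem homogeneousComponent_taylorMap (S : Finset (E d)) (k : E d → ℂ) (n : ℕ) (p : Poly d) :
    homogeneousComponent n (taylorMap S k p) = taylorOp S k n (homogeneousComponent n p) := by
  conv_lhs => rw [← sum_homogeneousComponent p, map_sum, map_sum]
  have h1 : ∀ j, homogeneousComponent n (taylorMap S k (homogeneousComponent j p))
      = if n = j then taylorOp S k n (homogeneousComponent n p) else 0 := fun j => by
    rw [taylorMap_of_isHomogeneous S k (homogeneousComponent_isHomogeneous j p),
      homogeneousComponent_of_mem (taylorOp_isHomogeneous S k j _)]
    split_ifs with h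
    · rw [h]
    · rfl
  simp only [h1, Finset.sum_ite_eq, Finset.mem_range, Nat.lt_succ_iff]
  split_ifs with h
  · rfl
  · rw [homogeneousComponent_eq_zero _ _ (not_le.mp h), map_zero]

/-- An injective endomorphism of the finite-dimensional space 𝒫_n is surjective. -/
theorem exists_taylorOp_eq (hS : (0 : E d) ∉ S) (hE : Equivariant S k) (hW : EulerInjective S k)
    (n : ℕ) {q : Poly d} (hq : q.IsHomogeneous n) :
    ∃ p : Poly d, p.IsHomogeneous n ∧ taylorOp S k n p = q := by
  let H := homogeneousSubmodule (Fin d) ℂ n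
  have : FiniteDimensional ℂ H :=
    Module.Finite.iff_fg.mpr (homogeneousSubmodule_fg (Fin d) ℂ n)
  let f : H →ₗ[ℂ] H := (taylorOp S k n).restrict fun p _ => taylorOp_isHomogeneous S k n p
  have hf : Function.Injective f := by
    rw [← LinearMap.ker_eq_bot, LinearMap.ker_eq_bot']
    intro p hp
    exact Subtype.ext (taylorOp_injective hS hE hW n p.2 (congrArg Subtype.val hp))
  obtain ⟨p, hp⟩ := LinearMap.injective_iff_surjective.mp hf ⟨q, hq⟩
  exact ⟨p, p.2, congrArg Subtype.val hp⟩

theorem taylorMap_bijective (hS : (0 : E d) ∉ S) (hE : Equivariant S k)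
    (hW : EulerInjective S k) : Function.Bijective (taylorMap S k) := by
  constructor
  · rw [← LinearMap.ker_eq_bot, LinearMap.ker_eq_bot']
    intro p hp
    rw [← sum_homogeneousComponent p]
    refine Finset.sum_eq_zero fun n _ => ?_
    apply taylorOp_injective hS hE hW n (homogeneousComponent_isHomogeneous n p)
    rw [← homogeneousComponent_taylorMap, hp, map_zero]
  · intro q
    choose p hp hpq using fun n =>
      exists_taylorOp_eq hS hE hW n (homogeneousComponent_isHomogeneous n q)
    refine ⟨∑ n ∈ Finset.range (q.totalDegree + 1), p n, ?_⟩
    conv_rhs => rw [← sum_homogeneousComponent q]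
    rw [map_sum]
    exact Finset.sum_congr rfl fun n _ => by rw [taylorMap_of_isHomogeneous S k (hp n), hpq]

theorem taylorMap_dunklPoly (hS : (0 : E d) ∉ S) (hE : Equivariant S k) (i : Fin d) (p : Poly d) :
    pderiv i (taylorMap S k p)
      = taylorMap S k (dunklPoly S k (EuclideanSpace.single i 1) p) := by
  conv_lhs => rw [← sum_homogeneousComponent p]
  conv_rhs => rw [← sum_homogeneousComponent p]
  simp only [map_sum]
  refine Finset.sum_congr rfl fun n _ => ?_
  have hp := homogeneousComponent_isHomogeneous n p
  rw [taylorMap_of_isHomogeneous S k hp,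
    taylorMap_of_isHomogeneous S k (dunklPoly_isHomogeneous hS k _ hp)]
  cases n with
  | zero =>
    rw [taylorOp_zero, pderiv_C, homogeneousComponent_zero, dunklPoly_C hS, map_zero]
  | succ n => rw [pderiv_taylorOp hS hE, Nat.add_sub_cancel]

theorem dunklPoly_eq_sum (ξ : E d) (p : Poly d) : dunklPoly S k ξ p
    = ∑ j, ((ξ j : ℝ) : ℂ) • dunklPoly S k (EuclideanSpace.single j 1) p := by
  have h : ξ = ∑ j, ξ j • EuclideanSpace.single j (1 : ℝ) := by
    ext i; simp [Pi.single_apply]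
  let f : E d →+ Poly d :=
    { toFun := fun ξ => dunklPoly S k ξ p
      map_zero' := by simpa using dunklPoly_smul_dir (S := S) (k := k) 0 0 p
      map_add' := fun ξ η => dunklPoly_add_dir ξ η p }
  calc dunklPoly S k ξ p = f (∑ j, ξ j • EuclideanSpace.single j (1 : ℝ)) := by
        rw [← h]; rfl
    _ = _ := by
        rw [map_sum]
        exact Finset.sum_congr rfl fun j _ => dunklPoly_smul_dir _ _ _

/-- The intertwining relations at the level of polynomials. -/
theorem IsIntertwining.dunklPoly (hS : (0 : E d) ∉ S) {V : Poly d ≃ₗ[ℂ] Poly d}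
    (hV : IsIntertwining S k V) (ξ : E d) (p : Poly d) :
    dunklPoly S k ξ (V p) = V (dirD ξ p) := by
  apply polyFun_injective
  rw [← dunklOp_polyFun hS, hV.intertwine, dirD_apply]

theorem exists_isIntertwining (hS : (0 : E d) ∉ S) (hE : Equivariant S k)
    (hW : EulerInjective S k) : ∃ V : Poly d ≃ₗ[ℂ] Poly d, IsIntertwining S k V := by
  let U := LinearEquiv.ofBijective (taylorMap S k) (taylorMap_bijective hS hE hW)
  have hU : ∀ p, U p = taylorMap S k p := fun _ => rfl
  refine ⟨U.symm, ⟨fun n p hp => ?_, ?_, fun ξ p => ?_⟩⟩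
  · obtain ⟨q, hq, hqp⟩ := exists_taylorOp_eq hS hE hW n hp
    have : U.symm p = q := by
      rw [LinearEquiv.symm_apply_eq, hU, taylorMap_of_isHomogeneous S k hq, hqp]
    rwa [this]
  · rw [LinearEquiv.symm_apply_eq, hU, taylorMap_of_isHomogeneous S k (isHomogeneous_one _ _),
      taylorOp_zero]
    simp
  · rw [dunklOp_polyFun hS]
    congr 1
    symm
    rw [LinearEquiv.symm_apply_eq, hU, dunklPoly_eq_sum, map_sum]
    refine Finset.sum_congr rfl fun j _ => ?_
    rw [map_smul, ← taylorMap_dunklPoly hS hE, ← hU, LinearEquiv.apply_symm_apply, smul_eq_C_mul]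

theorem IsIntertwining.eq (hS : (0 : E d) ∉ S) (hW : EulerInjective S k)
    {V V' : Poly d ≃ₗ[ℂ] Poly d} (hV : IsIntertwining S k V) (hV' : IsIntertwining S k V') :
    V = V' := by
  have key : ∀ (n : ℕ) (p : Poly d), p.IsHomogeneous n → V p = V' p := by
    intro n
    induction n with
    | zero =>
      intro p hp
      rw [← totalDegree_zero_iff_isHomogeneous, totalDegree_eq_zero_iff_eq_C] at hp
      rw [hp, ← mul_one (C _), ← smul_eq_C_mul, map_smul, map_smul, hV.map_one, hV'.map_one]
    | succ n ih =>
      intro p hp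
      rw [← sub_eq_zero]
      -- By induction on the degree, each T_j kills the difference of the two images.
      refine hW.eq_zero_of_dunklPoly hS (Nat.succ_pos n)
        ((hV.map_homogeneous _ p hp).sub (hV'.map_homogeneous _ p hp)) fun j => ?_
      rw [map_sub, hV.dunklPoly hS, hV'.dunklPoly hS, ih _ (dirD_isHomogeneous _ hp), sub_self]
  ext1 p
  rw [← sum_homogeneousComponent p, map_sum, map_sum]
  exact Finset.sum_congr rfl fun n _ => key n _ (homogeneousComponent_isHomogeneous n p)

theorem isIntertwining_intertwiningOp (hS : (0 : E d) ∉ S) (hE : Equivariant S k)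
    (hW : EulerInjective S k) : IsIntertwining S k (intertwiningOp S k) :=
  Classical.epsilon_spec (exists_isIntertwining hS hE hW)

/-! ### Weighted coefficient norms. -/

section WeightedNorm

variable {σ τ : Type*}

/-- The weighted `ℓ¹`-norm `∑ |c_ν| r^|ν|` of the coefficients of a polynomial. -/
def wnorm (r : ℝ) (p : MvPolynomial σ ℂ) : ℝ := ∑ ν ∈ p.support, ‖coeff ν p‖ * r ^ ν.degree

theorem wnorm_nonneg {r : ℝ} (hr : 0 ≤ r) (p : MvPolynomial σ ℂ) : 0 ≤ wnorm r p :=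
  Finset.sum_nonneg fun _ _ => by positivity

theorem wnorm_eq_sum (r : ℝ) {p : MvPolynomial σ ℂ} {s : Finset (σ →₀ ℕ)} (h : p.support ⊆ s) :
    wnorm r p = ∑ ν ∈ s, ‖coeff ν p‖ * r ^ ν.degree :=
  Finset.sum_subset h fun ν _ hν => by
    rw [notMem_support_iff.mp hν, norm_zero, zero_mul]

@[simp] theorem wnorm_zero (r : ℝ) : wnorm r (0 : MvPolynomial σ ℂ) = 0 := by simp [wnorm]

theorem wnorm_add_le {r : ℝ} (hr : 0 ≤ r) (p q : MvPolynomial σ ℂ) :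
    wnorm r (p + q) ≤ wnorm r p + wnorm r q := by
  classical
  rw [wnorm_eq_sum r (support_add (p := p) (q := q)),
    wnorm_eq_sum r (Finset.subset_union_left (s₁ := p.support) (s₂ := q.support)),
    wnorm_eq_sum r (Finset.subset_union_right (s₁ := p.support) (s₂ := q.support)),
    ← Finset.sum_add_distrib]
  refine Finset.sum_le_sum fun ν _ => ?_
  rw [coeff_add, ← add_mul]
  gcongr
  exact norm_add_le _ _

theorem wnorm_sum_le {r : ℝ} (hr : 0 ≤ r) {ι : Type*} (s : Finset ι) (f : ι → MvPolynomial σ ℂ) :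
    wnorm r (∑ i ∈ s, f i) ≤ ∑ i ∈ s, wnorm r (f i) := by
  classical
  induction s using Finset.induction_on with
  | empty => simp
  | insert a s ha ih =>
    rw [Finset.sum_insert ha, Finset.sum_insert ha]
    exact (wnorm_add_le hr _ _).trans (by gcongr)

theorem wnorm_smul (r : ℝ) (c : ℂ) (p : MvPolynomial σ ℂ) :
    wnorm r (c • p) = ‖c‖ * wnorm r p := by
  rw [wnorm_eq_sum r (support_smul (a := c) (f := p)), wnorm, Finset.mul_sum]
  exact Finset.sum_congr rfl fun ν _ => by rw [coeff_smul, smul_eq_mul, norm_mul, mul_assoc]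

theorem wnorm_monomial (r : ℝ) (ν : σ →₀ ℕ) (c : ℂ) :
    wnorm r (monomial ν c) = ‖c‖ * r ^ ν.degree := by
  classical
  rw [wnorm_eq_sum r (support_monomial_subset (s := ν) (a := c))]
  simp

theorem wnorm_one (r : ℝ) : wnorm r (1 : MvPolynomial σ ℂ) = 1 := by
  have := wnorm_monomial r (0 : σ →₀ ℕ) 1
  simpa using this

theorem wnorm_X (r : ℝ) (i : σ) : wnorm r (X i : MvPolynomial σ ℂ) = r := by
  rw [X, wnorm_monomial]; simp

/-- For an ℓ¹-norm, a bound for a linear map need only be checked on monomials. -/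
theorem wnorm_map_le {r s C : ℝ} (hr : 0 ≤ r)
    (f : MvPolynomial σ ℂ →ₗ[ℂ] MvPolynomial τ ℂ)
    (hf : ∀ ν : σ →₀ ℕ, wnorm r (f (monomial ν 1)) ≤ C * s ^ ν.degree) (p : MvPolynomial σ ℂ) :
    wnorm r (f p) ≤ C * wnorm s p := by
  have h1 : f p = ∑ ν ∈ p.support, coeff ν p • f (monomial ν 1) := by
    conv_lhs => rw [p.as_sum, map_sum]
    refine Finset.sum_congr rfl fun ν _ => ?_
    rw [← map_smul, smul_monomial, smul_eq_mul, mul_one]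
  have h2 : wnorm s p = ∑ ν ∈ p.support, ‖coeff ν p‖ * s ^ ν.degree := rfl
  rw [h1, h2, Finset.mul_sum]
  refine (wnorm_sum_le hr _ _).trans (Finset.sum_le_sum fun ν _ => ?_)
  rw [wnorm_smul, mul_left_comm]
  exact mul_le_mul_of_nonneg_left (hf ν) (norm_nonneg _)

theorem wnorm_mul_le {r : ℝ} (hr : 0 ≤ r) (p q : MvPolynomial σ ℂ) :
    wnorm r (p * q) ≤ wnorm r p * wnorm r q := by
  have h1 : ∀ (ν : σ →₀ ℕ), wnorm r (monomial ν 1 * q) ≤ wnorm r q * r ^ ν.degree := fun ν => by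
    rw [mul_comm (wnorm r q)]
    refine wnorm_map_le hr (LinearMap.mulLeft ℂ (monomial ν (1 : ℂ))) (fun μ => ?_) q
    rw [LinearMap.mulLeft_apply, monomial_mul, wnorm_monomial, map_add, pow_add]
    simp
  rw [mul_comm (wnorm r p)]
  exact wnorm_map_le hr (LinearMap.mulRight ℂ q) h1 p

theorem wnorm_pow_le {r : ℝ} (hr : 0 ≤ r) (p : MvPolynomial σ ℂ) (n : ℕ) :
    wnorm r (p ^ n) ≤ wnorm r p ^ n := by
  induction n with
  | zero => simp [wnorm_one]
  | succ n ih =>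
    rw [pow_succ, pow_succ]
    exact (wnorm_mul_le hr _ _).trans (mul_le_mul_of_nonneg_right ih (wnorm_nonneg hr _))

theorem wnorm_prod_le {r : ℝ} (hr : 0 ≤ r) {ι : Type*} (s : Finset ι)
    (f : ι → MvPolynomial σ ℂ) : wnorm r (∏ i ∈ s, f i) ≤ ∏ i ∈ s, wnorm r (f i) := by
  classical
  induction s using Finset.induction_on with
  | empty => simp [wnorm_one]
  | insert a s ha ih =>
    rw [Finset.prod_insert ha, Finset.prod_insert ha]
    exact (wnorm_mul_le hr _ _).trans (mul_le_mul_of_nonneg_left ih (wnorm_nonneg hr _))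

theorem wnorm_of_isHomogeneous (r : ℝ) {n : ℕ} {p : MvPolynomial σ ℂ} (hp : p.IsHomogeneous n) :
    wnorm r p = r ^ n * wnorm 1 p := by
  rw [wnorm, wnorm, Finset.mul_sum]
  refine Finset.sum_congr rfl fun ν hν => ?_
  have : ν.degree = n := by
    by_contra h
    exact mem_support_iff.mp hν (hp.coeff_eq_zero h)
  rw [this]; simp [mul_comm]

/-- The factor ν_i ≤ 2^|ν| is absorbed by doubling the radius; r ≥ 1 allows for the lost degree. -/
theorem wnorm_pderiv_le {r : ℝ} (hr : 1 ≤ r) (i : σ) (p : MvPolynomial σ ℂ) :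
    wnorm r (pderiv i p) ≤ wnorm (2 * r) p := by
  have h0 : 0 ≤ r := zero_le_one.trans hr
  rw [← one_mul (wnorm (2 * r) p)]
  refine wnorm_map_le h0 (pderiv i : Derivation ℂ (MvPolynomial σ ℂ) (MvPolynomial σ ℂ)).toLinearMap
    (fun ν => ?_) p
  change wnorm r (pderiv i (monomial ν 1)) ≤ _
  rw [pderiv_monomial, wnorm_monomial, one_mul, one_mul, mul_pow]
  have h1 : ((ν i : ℕ) : ℝ) ≤ 2 ^ ν.degree := by
    have : ν i ≤ 2 ^ ν.degree := (Finsupp.le_degree i ν).trans Nat.lt_two_pow_self.le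
    exact_mod_cast this
  have h2 : r ^ (ν - Finsupp.single i 1).degree ≤ r ^ ν.degree :=
    pow_le_pow_right₀ hr (Finsupp.degree_mono tsub_le_self)
  rw [RCLike.norm_natCast]
  gcongr

theorem norm_eval_le {r : ℝ} {z : σ → ℂ} (hz : ∀ i, ‖z i‖ ≤ r) (p : MvPolynomial σ ℂ) :
    ‖eval z p‖ ≤ wnorm r p := by
  rw [eval_eq]
  refine (norm_sum_le _ _).trans (Finset.sum_le_sum fun ν _ => ?_)
  rw [norm_mul, norm_prod, Finsupp.degree_apply, ← Finset.prod_pow_eq_pow_sum]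
  gcongr with i _
  rw [norm_pow]
  exact pow_le_pow_left₀ (norm_nonneg _) (hz i) _

theorem wnorm_rename_le {r : ℝ} (hr : 0 ≤ r) (f : σ → τ) (p : MvPolynomial σ ℂ) :
    wnorm r (rename f p) ≤ wnorm r p := by
  rw [← one_mul (wnorm r p)]
  refine wnorm_map_le hr (rename f : _ →ₐ[ℂ] MvPolynomial τ ℂ).toLinearMap (fun ν => ?_) p
  change wnorm r (rename f (monomial ν 1)) ≤ _
  rw [rename_monomial, wnorm_monomial, Finsupp.degree_mapDomain]
  simp

end WeightedNorm

/-! ### Growth of the intertwining operator. -/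

theorem wnorm_lin_le {r : ℝ} (hr : 0 ≤ r) (α : E d) : wnorm r (lin α) ≤ d * ‖α‖ * r := by
  refine (wnorm_sum_le hr _ _).trans ?_
  have : ∀ j ∈ (Finset.univ : Finset (Fin d)), wnorm r (C ((α j : ℝ) : ℂ) * X j : Poly d)
      ≤ ‖α‖ * r := fun j _ => by
    rw [← smul_eq_C_mul, wnorm_smul, wnorm_X, Complex.norm_real]
    gcongr
    exact PiLp.norm_apply_le α j
  refine (Finset.sum_le_sum this).trans ?_
  simp [mul_assoc]

theorem wnorm_act_le (g : E d ≃ₗᵢ[ℝ] E d) (p : Poly d) : wnorm 1 (act g p) ≤ wnorm d p := by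
  rw [← one_mul (wnorm d p)]
  refine wnorm_map_le zero_le_one (act g).toLinearMap (fun ν => ?_) p
  change wnorm 1 (act g (monomial ν 1)) ≤ _
  rw [act, aeval_monomial, map_one, one_mul, one_mul, Finsupp.prod, Finsupp.degree_apply,
    ← Finset.prod_pow_eq_pow_sum]
  refine (wnorm_prod_le zero_le_one _ _).trans ?_
  refine Finset.prod_le_prod (fun i _ => wnorm_nonneg zero_le_one _) fun i _ => ?_
  refine (wnorm_pow_le zero_le_one _ _).trans ?_
  refine pow_le_pow_left₀ (wnorm_nonneg zero_le_one _) ?_ _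
  refine (wnorm_lin_le zero_le_one _).trans ?_
  simp

/-- The supremum of the coefficient norms over the orbit under the orthogonal group. -/
def isoNorm (p : Poly d) : ℝ := ⨆ g : E d ≃ₗᵢ[ℝ] E d, wnorm 1 (act g p)

theorem wnorm_act_le_isoNorm (g : E d ≃ₗᵢ[ℝ] E d) (p : Poly d) : wnorm 1 (act g p) ≤ isoNorm p :=
  le_ciSup (f := fun g : E d ≃ₗᵢ[ℝ] E d => wnorm 1 (act g p))
    ⟨wnorm d p, by rintro _ ⟨g, rfl⟩; exact wnorm_act_le g p⟩ g

theorem isoNorm_le {p : Poly d} {c : ℝ} (h : ∀ g : E d ≃ₗᵢ[ℝ] E d, wnorm 1 (act g p) ≤ c) :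
    isoNorm p ≤ c := ciSup_le h

theorem isoNorm_nonneg (p : Poly d) : 0 ≤ isoNorm p :=
  (wnorm_nonneg zero_le_one _).trans (wnorm_act_le_isoNorm (.refl ℝ _) p)

theorem wnorm_one_le_isoNorm (p : Poly d) : wnorm 1 p ≤ isoNorm p := by
  have h : act (.refl ℝ (E d)) p = p := poly_ext fun x => by simp
  simpa [h] using wnorm_act_le_isoNorm (.refl ℝ _) p

/-- This is the purpose of the supremum: in `wnorm` alone a reflection could cost d^n in degree n,
which would ruin the lower bound for W_n. -/
theorem isoNorm_act_le (g : E d ≃ₗᵢ[ℝ] E d) (p : Poly d) : isoNorm (act g p) ≤ isoNorm p :=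
  isoNorm_le fun h => by rw [act_act]; exact wnorm_act_le_isoNorm _ _

theorem isoNorm_add_le (p q : Poly d) : isoNorm (p + q) ≤ isoNorm p + isoNorm q :=
  isoNorm_le fun g => by
    rw [map_add]
    exact (wnorm_add_le zero_le_one _ _).trans
      (add_le_add (wnorm_act_le_isoNorm g p) (wnorm_act_le_isoNorm g q))

theorem isoNorm_smul_le (c : ℂ) (p : Poly d) : isoNorm (c • p) ≤ ‖c‖ * isoNorm p :=
  isoNorm_le fun g => by
    rw [map_smul, wnorm_smul]
    exact mul_le_mul_of_nonneg_left (wnorm_act_le_isoNorm g p) (norm_nonneg _)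

theorem isoNorm_zero : isoNorm (0 : Poly d) = 0 :=
  le_antisymm (isoNorm_le fun g => by simp) (isoNorm_nonneg _)

theorem isoNorm_sum_le {ι : Type*} (s : Finset ι) (f : ι → Poly d) :
    isoNorm (∑ i ∈ s, f i) ≤ ∑ i ∈ s, isoNorm (f i) := by
  classical
  induction s using Finset.induction_on with
  | empty => simp [isoNorm_zero]
  | insert a s ha ih =>
    rw [Finset.sum_insert ha, Finset.sum_insert ha]
    exact (isoNorm_add_le _ _).trans (by gcongr)

theorem isoNorm_X_mul_le (j : Fin d) (p : Poly d) : isoNorm (X j * p) ≤ d * isoNorm p :=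
  isoNorm_le fun g => by
    rw [map_mul, ← lin_single, act_lin]
    refine (wnorm_mul_le zero_le_one _ _).trans ?_
    refine mul_le_mul ?_ (wnorm_act_le_isoNorm g p) (wnorm_nonneg zero_le_one _) (Nat.cast_nonneg _)
    refine (wnorm_lin_le zero_le_one _).trans ?_
    simp

/-- Solve for n p in the definition of W_n p; each of the two remaining sums costs at most ∑ ‖k(α)‖.
-/
theorem isoNorm_le_eulerPoly (S : Finset (E d)) (k : E d → ℂ) (n : ℕ) (p : Poly d) :
    (n - 2 * ∑ α ∈ S, ‖k α‖) * isoNorm p ≤ isoNorm (eulerPoly S k n p) := by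
  have h1 : (n : ℂ) • p = eulerPoly S k n p
      + ((-∑ α ∈ S, k α) • p + ∑ α ∈ S, k α • act (refl α) p) := by
    rw [eulerPoly]; module
  have h2 : isoNorm ((n : ℂ) • p) = n * isoNorm p := by
    refine le_antisymm ((isoNorm_smul_le _ _).trans (by simp)) ?_
    rcases Nat.eq_zero_or_pos n with rfl | hn
    · simp [isoNorm_nonneg]
    · have hn' : (n : ℂ) ≠ 0 := by exact_mod_cast hn.ne'
      have h := isoNorm_smul_le ((n : ℂ)⁻¹) ((n : ℂ) • p)
      rw [inv_smul_smul₀ hn', norm_inv, RCLike.norm_natCast] at h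
      rwa [← le_inv_mul_iff₀ (by exact_mod_cast hn)]
  have h3 : isoNorm ((-∑ α ∈ S, k α) • p) ≤ (∑ α ∈ S, ‖k α‖) * isoNorm p := by
    refine (isoNorm_smul_le _ _).trans (mul_le_mul_of_nonneg_right ?_ (isoNorm_nonneg _))
    rw [norm_neg]; exact norm_sum_le _ _
  have h4 : isoNorm (∑ α ∈ S, k α • act (refl α) p) ≤ (∑ α ∈ S, ‖k α‖) * isoNorm p := by
    rw [Finset.sum_mul]
    refine (isoNorm_sum_le _ _).trans (Finset.sum_le_sum fun α _ => ?_)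
    exact (isoNorm_smul_le _ _).trans
      (mul_le_mul_of_nonneg_left (isoNorm_act_le _ _) (norm_nonneg _))
  have h6 := isoNorm_add_le (eulerPoly S k n p)
    ((-∑ α ∈ S, k α) • p + ∑ α ∈ S, k α • act (refl α) p)
  have h7 := isoNorm_add_le ((-∑ α ∈ S, k α) • p) (∑ α ∈ S, k α • act (refl α) p)
  rw [← h1, h2] at h6
  linarith

theorem IsIntertwining.eulerPoly (hS : (0 : E d) ∉ S) {V : Poly d ≃ₗ[ℂ] Poly d}
    (hV : IsIntertwining S k V) {n : ℕ} {p : Poly d} (hp : p.IsHomogeneous n) :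
    eulerPoly S k n (V p) = ∑ j, X j * V (pderiv j p) := by
  rw [← sum_X_mul_dunklPoly hS k (hV.map_homogeneous n p hp)]
  refine Finset.sum_congr rfl fun j _ => ?_
  rw [hV.dunklPoly hS, dirD_apply, Finset.sum_eq_single j (fun i _ hi => by simp [hi]) (by simp)]
  simp

/-- In the recursion W_(m+1) V p = ∑ X_j V ∂_j p, the exponents ν_j sum to m + 1, while W_(m+1) is
bounded below by (m + 1)/2. The quotient is 2, and d is the cost of multiplying by X_j, so the
growth is geometric. -/
theorem IsIntertwining.isoNorm_monomial_le (hS : (0 : E d) ∉ S) {V : Poly d ≃ₗ[ℂ] Poly d}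
    (hV : IsIntertwining S k V) {m : ℕ} (hm : 4 * ∑ α ∈ S, ‖k α‖ ≤ m + 1) {B : ℝ}
    (hB : ∀ ν : Fin d →₀ ℕ, ν.degree = m → isoNorm (V (monomial ν 1)) ≤ B)
    {ν : Fin d →₀ ℕ} (hn : ν.degree = m + 1) :
    isoNorm (V (monomial ν 1)) ≤ 2 * d * B := by
  have h1 := isoNorm_le_eulerPoly S k (m + 1) (V (monomial ν 1))
  rw [hV.eulerPoly hS (isHomogeneous_monomial 1 hn)] at h1
  have h2 : ∀ j ∈ Finset.univ, isoNorm (X j * V (pderiv j (monomial ν 1)))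
      ≤ d * (ν j * B) := fun j _ => by
    refine (isoNorm_X_mul_le _ _).trans (mul_le_mul_of_nonneg_left ?_ (Nat.cast_nonneg d))
    rw [pderiv_monomial, one_mul, ← mul_one ((ν j : ℕ) : ℂ), ← smul_eq_mul, ← smul_monomial,
      map_smul]
    refine (isoNorm_smul_le _ _).trans ?_
    rw [RCLike.norm_natCast]
    -- If ν_j = 0 the truncated exponent does not have degree m, but the coefficient is zero.
    rcases Nat.eq_zero_or_pos (ν j) with h0 | h0
    · simp [h0]
    · refine mul_le_mul_of_nonneg_left (hB _ ?_) (Nat.cast_nonneg _)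
      have h3 : ν - Finsupp.single j 1 + Finsupp.single j 1 = ν :=
        tsub_add_cancel_of_le (by rw [Finsupp.single_le_iff]; exact h0)
      have h4 := congrArg Finsupp.degree h3
      rw [map_add, Finsupp.degree_single, hn] at h4
      exact Nat.succ_injective h4
  have h3 : ∑ j, (ν j : ℝ) = m + 1 := by
    rw [Finsupp.degree_eq_sum] at hn
    exact_mod_cast hn
  have h5 := h1.trans ((isoNorm_sum_le _ _).trans (Finset.sum_le_sum h2))
  rw [← Finset.mul_sum, ← Finset.sum_mul, h3, Nat.cast_succ] at h5
  have hx := isoNorm_nonneg (V (monomial ν 1))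
  generalize isoNorm (V (monomial ν 1)) = x at h5 hx ⊢
  have hm0 : (0 : ℝ) < m + 1 := by positivity
  refine le_of_mul_le_mul_left ?_ (half_pos hm0)
  have h6 : ((m : ℝ) + 1) / 2 * x ≤ (m + 1 - 2 * ∑ α ∈ S, ‖k α‖) * x :=
    mul_le_mul_of_nonneg_right (by linarith) hx
  exact (h6.trans h5).trans_eq (by ring)

theorem IsIntertwining.exists_isoNorm_le (hS : (0 : E d) ∉ S) {V : Poly d ≃ₗ[ℂ] Poly d}
    (hV : IsIntertwining S k V) : ∃ C A : ℝ, 0 ≤ C ∧ 1 ≤ A ∧ ∀ ν : Fin d →₀ ℕ,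
      isoNorm (V (monomial ν 1)) ≤ C * A ^ ν.degree := by
  obtain ⟨n₀, hn₀⟩ := exists_nat_gt (4 * ∑ α ∈ S, ‖k α‖)
  -- The finitely many degrees in which the recursive bound is unavailable are absorbed into the
  -- constant C.
  let F := (Finsupp.finite_of_degree_lt (σ := Fin d) n₀).toFinset
  set C := ∑ ν ∈ F, isoNorm (V (monomial ν 1)) with hC
  have hC0 : 0 ≤ C := Finset.sum_nonneg fun _ _ => isoNorm_nonneg _
  have hd : (0 : ℝ) ≤ d := Nat.cast_nonneg d
  have hA : (1 : ℝ) ≤ 2 * d + 1 := by linarith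
  refine ⟨C, 2 * d + 1, hC0, hA, ?_⟩
  suffices h : ∀ (n : ℕ) (ν : Fin d →₀ ℕ), ν.degree = n →
      isoNorm (V (monomial ν 1)) ≤ C * (2 * d + 1) ^ n from fun ν => h _ ν rfl
  have hsmall : ∀ (n : ℕ) (ν : Fin d →₀ ℕ), ν.degree = n → n < n₀ →
      isoNorm (V (monomial ν 1)) ≤ C * (2 * d + 1) ^ n := fun n ν hn hlt => by
    have h1 : isoNorm (V (monomial ν 1)) ≤ C :=
      Finset.single_le_sum (f := fun ν => isoNorm (V (monomial ν 1)))
        (fun _ _ => isoNorm_nonneg _) (by simpa [F, hn] using hlt)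
    exact h1.trans (le_mul_of_one_le_right hC0 (one_le_pow₀ hA))
  intro n
  induction n with
  | zero =>
    refine fun ν hn => hsmall 0 ν hn (Nat.pos_of_ne_zero ?_)
    rintro rfl
    have : 0 ≤ 4 * ∑ α ∈ S, ‖k α‖ := by positivity
    simp only [Nat.cast_zero] at hn₀
    linarith
  | succ m ih =>
    intro ν hn
    by_cases hlt : m + 1 < n₀
    · exact hsmall _ ν hn hlt
    · have hle : (n₀ : ℝ) ≤ m + 1 := by exact_mod_cast not_lt.mp hlt
      refine (hV.isoNorm_monomial_le hS (hn₀.le.trans hle) ih hn).trans ?_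
      have h8 : 0 ≤ C * (2 * (d : ℝ) + 1) ^ m := by positivity
      rw [pow_succ']
      linarith

theorem IsIntertwining.exists_wnorm_le (hS : (0 : E d) ∉ S) {V : Poly d ≃ₗ[ℂ] Poly d}
    (hV : IsIntertwining S k V) : ∃ C A : ℝ, 0 ≤ C ∧ 1 ≤ A ∧ ∀ (r : ℝ) (p : Poly d), 0 ≤ r →
      wnorm r (V p) ≤ C * wnorm (A * r) p := by
  obtain ⟨C, A, hC, hA, h⟩ := hV.exists_isoNorm_le hS
  refine ⟨C, A, hC, hA, fun r p hr => wnorm_map_le hr V.toLinearMap (fun ν => ?_) p⟩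
  change wnorm r (V (monomial ν 1)) ≤ _
  rw [wnorm_of_isHomogeneous r (hV.map_homogeneous _ _ (isHomogeneous_monomial 1 rfl)), mul_pow,
    ← mul_assoc, mul_comm]
  exact mul_le_mul_of_nonneg_right ((wnorm_one_le_isoNorm _).trans (h ν)) (by positivity)

/-! ### Series of polynomials that converge with all derivatives. -/

section Series

variable {W : Type*} [NormedAddCommGroup W] [NormedSpace ℝ W] {σ ι : Type*}

/-- Evaluation of a polynomial at the point with the real coordinates `c i z`. -/
def realEval (c : σ → W →L[ℝ] ℝ) (p : MvPolynomial σ ℂ) (z : W) : ℂ :=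
  eval (fun i => ((c i z : ℝ) : ℂ)) p

/-- A family of polynomials whose coefficients are summable with all geometric weights. -/
def EntireFamily (P : ι → MvPolynomial σ ℂ) : Prop :=
  ∀ r : ℝ, 1 ≤ r → Summable fun i => wnorm r (P i)

theorem EntireFamily.pderiv {P : ι → MvPolynomial σ ℂ} (hP : EntireFamily P) (j : σ) :
    EntireFamily fun i => pderiv j (P i) := fun r hr =>
  Summable.of_nonneg_of_le (fun _ => wnorm_nonneg (zero_le_one.trans hr) _)
    (fun i => wnorm_pderiv_le hr j (P i)) (hP (2 * r) (by linarith))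

variable {c : σ → W →L[ℝ] ℝ}

theorem norm_realEval_le (hc : ∀ i, ‖c i‖ ≤ 1) {r : ℝ} {z : W} (hz : ‖z‖ ≤ r)
    (p : MvPolynomial σ ℂ) : ‖realEval c p z‖ ≤ wnorm r p :=
  norm_eval_le (fun i => by
    rw [Complex.norm_real]
    exact ((c i).le_of_opNorm_le (hc i) z).trans (by simpa using hz)) p

theorem EntireFamily.summable {P : ι → MvPolynomial σ ℂ} (hP : EntireFamily P)
    (hc : ∀ i, ‖c i‖ ≤ 1) (z : W) : Summable fun i => realEval c (P i) z :=
  Summable.of_norm_bounded (hP (‖z‖ + 1) (by linarith [norm_nonneg z])) fun i =>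
    norm_realEval_le hc (by linarith) (P i)

variable [Fintype σ]

theorem hasFDerivAt_realEval (c : σ → W →L[ℝ] ℝ) (p : MvPolynomial σ ℂ) (z : W) :
    HasFDerivAt (realEval c p) (∑ j, (c j).smulRight (realEval c (pderiv j p) z)) z := by
  classical
  induction p using MvPolynomial.induction_on with
  | C a =>
    have h1 : realEval c (C a) = fun _ => a := by ext y; simp [realEval]
    rw [h1]
    refine (hasFDerivAt_const a z).congr_fderiv ?_
    ext v; simp [realEval]
  | add p q hp hq =>
    have h1 : realEval c (p + q) = fun y => realEval c p y + realEval c q y := by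
      ext y; simp [realEval]
    rw [h1]
    refine (hp.add hq).congr_fderiv ?_
    ext v
    simp [realEval, Finset.sum_add_distrib]
  | mul_X p i hp =>
    have h1 : realEval c (p * X i) = fun y => realEval c p y * ((c i y : ℝ) : ℂ) := by
      ext y; simp [realEval]
    rw [h1]
    have hX : HasFDerivAt (fun y => ((c i y : ℝ) : ℂ)) (Complex.ofRealCLM.comp (c i)) z :=
      (Complex.ofRealCLM.comp (c i)).hasFDerivAt
    refine (hp.mul hX).congr_fderiv ?_
    have h2 : ∀ j, realEval c (MvPolynomial.pderiv j (p * X i)) z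
        = (if j = i then realEval c p z else 0)
          + ((c i z : ℝ) : ℂ) * realEval c (MvPolynomial.pderiv j p) z := fun j => by
      rw [Derivation.leibniz, pderiv_X, Pi.single_apply]
      by_cases h : j = i
      · subst h; simp [realEval]
      · simp [realEval, h, Ne.symm h]
    ext v
    simp only [h2]
    simp [Finset.sum_add_distrib, Finset.mul_sum, mul_left_comm]
    exact mul_comm _ _

/-- On the ball of radius ‖z‖ + 1 the derivatives are dominated by a summable sequence of norms, so
termwise differentiation is allowed. -/
theorem EntireFamily.hasFDerivAt_tsum {P : ι → MvPolynomial σ ℂ} (hP : EntireFamily P)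
    (hc : ∀ i, ‖c i‖ ≤ 1) (z : W) :
    HasFDerivAt (fun z => ∑' i, realEval c (P i) z)
      (∑ j, (c j).smulRight (∑' i, realEval c (MvPolynomial.pderiv j (P i)) z)) z := by
  have hr : 1 ≤ ‖z‖ + 1 := by linarith [norm_nonneg z]
  have hu : Summable fun i => ∑ j, wnorm (‖z‖ + 1) (MvPolynomial.pderiv j (P i)) :=
    summable_sum fun j _ => hP.pderiv j _ hr
  have hz : z ∈ Metric.ball (0 : W) (‖z‖ + 1) := by simp
  have h := hasFDerivAt_tsum_of_isPreconnected hu Metric.isOpen_ball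
    (convex_ball (0 : W) (‖z‖ + 1)).isPreconnected
    (fun i y _ => hasFDerivAt_realEval c (P i) y) (fun i y hy => ?_) hz (hP.summable hc z) hz
  · refine h.congr_fderiv (HasSum.tsum_eq (hasSum_sum fun j _ => ?_))
    exact (ContinuousLinearMap.smulRightL ℝ W ℂ (c j)).hasSum ((hP.pderiv j).summable hc z).hasSum
  · refine (norm_sum_le _ _).trans (Finset.sum_le_sum fun j _ => ?_)
    rw [ContinuousLinearMap.norm_smulRight_apply]
    have h2 := norm_realEval_le hc (mem_ball_zero_iff.mp hy).le (MvPolynomial.pderiv j (P i))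
    exact (mul_le_of_le_one_left (norm_nonneg _) (hc j)).trans h2

theorem EntireFamily.hasSum_fderiv {P : ι → MvPolynomial σ ℂ} (hP : EntireFamily P)
    (hc : ∀ i, ‖c i‖ ≤ 1) (z v : W) :
    HasSum (fun i => fderiv ℝ (realEval c (P i)) z v)
      (fderiv ℝ (fun z => ∑' i, realEval c (P i) z) z v) := by
  rw [(hP.hasFDerivAt_tsum hc z).fderiv]
  simp only [fun i => (hasFDerivAt_realEval c (P i) z).fderiv, _root_.sum_apply,
    ContinuousLinearMap.smulRight_apply]
  exact hasSum_sum fun j _ => ((hP.pderiv j).summable hc z).hasSum.const_smul _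

/-- The partial derivatives are series of the same kind, so smoothness follows by induction on the
order. -/
theorem EntireFamily.contDiff_tsum {P : ι → MvPolynomial σ ℂ} (hP : EntireFamily P)
    (hc : ∀ i, ‖c i‖ ≤ 1) : ContDiff ℝ ∞ (fun z => ∑' i, realEval c (P i) z) := by
  rw [contDiff_infty]
  intro n
  induction n generalizing P with
  | zero =>
    rw [Nat.cast_zero, contDiff_zero]
    exact continuous_iff_continuousAt.mpr fun z => (hP.hasFDerivAt_tsum hc z).continuousAt
  | succ n ih =>
    rw [Nat.cast_succ, contDiff_succ_iff_hasFDerivAt]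
    exact ⟨_, ContDiff.sum fun j _ =>
      (ContinuousLinearMap.smulRightL ℝ W ℂ (c j)).contDiff.comp (ih (hP.pderiv j)),
      fun z => hP.hasFDerivAt_tsum hc z⟩

end Series

theorem lin_eq_sum_smul (y : E d) : lin y = ∑ j, ((y j : ℝ) : ℂ) • (X j : Poly d) :=
  Finset.sum_congr rfl fun _ _ => (smul_eq_C_mul _ _).symm

/-- The polynomial `‖·‖²`. -/
def normSq (d : ℕ) : Poly d := ∑ j, X j ^ 2

theorem dirD_normSq (ξ : E d) : dirD ξ (normSq d) = (2 : ℂ) • lin ξ := by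
  rw [normSq, lin, map_sum, Finset.smul_sum]
  refine Finset.sum_congr rfl fun j _ => ?_
  rw [Derivation.leibniz_pow, dirD, mkDerivation_X, smul_eq_C_mul, show (C 2 : Poly d) = 2 from map_ofNat C 2]
  simp
  ring

/-! ### Derivatives in y of functionals of ⟨·, y⟩^n. -/

section WeakCalculus

/-- Removing a factor ⟨·, y⟩ turns ℓ into its compositions with multiplication by X_j. Inductions on
n thus run over all functionals ℓ, and V followed by evaluation at x is one of them. -/
theorem linearMap_lin_pow_succ (ℓ : Poly d →ₗ[ℂ] ℂ) (n : ℕ) (y : E d) :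
    ℓ (lin y ^ (n + 1))
      = ∑ j, ((y j : ℝ) : ℂ) * (ℓ.comp (LinearMap.mulLeft ℂ (X j))) (lin y ^ n) := by
  rw [pow_succ']
  nth_rw 1 [lin_eq_sum_smul]
  rw [Finset.sum_mul, map_sum]
  exact Finset.sum_congr rfl fun j _ => by simp

theorem contDiff_linearMap_lin_pow (ℓ : Poly d →ₗ[ℂ] ℂ) (n : ℕ) {N : WithTop ℕ∞} :
    ContDiff ℝ N fun y : E d => ℓ (lin y ^ n) := by
  induction n generalizing ℓ with
  | zero => simpa using contDiff_const
  | succ n ih =>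
    simp only [linearMap_lin_pow_succ]
    exact ContDiff.sum fun j _ =>
      (Complex.ofRealCLM.comp (EuclideanSpace.proj j : E d →L[ℝ] ℝ)).contDiff.mul (ih _)

theorem fderiv_linearMap_lin_pow (ℓ : Poly d →ₗ[ℂ] ℂ) (n : ℕ) (y ξ : E d) :
    fderiv ℝ (fun y : E d => ℓ (lin y ^ n)) y ξ = n * ℓ (lin ξ * lin y ^ (n - 1)) := by
  induction n generalizing ℓ with
  | zero => simp
  | succ n ih =>
    simp only [linearMap_lin_pow_succ]
    have hX : ∀ j, HasFDerivAt (fun y : E d => ((y j : ℝ) : ℂ))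
        (Complex.ofRealCLM.comp (EuclideanSpace.proj j : E d →L[ℝ] ℝ)) y := fun j =>
      (Complex.ofRealCLM.comp (EuclideanSpace.proj j : E d →L[ℝ] ℝ)).hasFDerivAt
    have hℓ : ∀ j, HasFDerivAt
        (fun y : E d => (ℓ.comp (LinearMap.mulLeft ℂ (X j))) (lin y ^ n)) _ y := fun j =>
      ((contDiff_linearMap_lin_pow _ n (N := 1)).differentiable one_ne_zero y).hasFDerivAt
    rw [(HasFDerivAt.fun_sum fun j _ => (hX j).fun_mul (hℓ j)).fderiv]
    have h1 : ∀ (v : E d) (q : Poly d), ∑ j, ((v j : ℝ) : ℂ) * ℓ (X j * q) = ℓ (lin v * q) :=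
      fun v q => by
        rw [lin_eq_sum_smul, Finset.sum_mul, map_sum]
        exact Finset.sum_congr rfl fun j _ => by simp
    have h2 : n * ℓ (lin y * (lin ξ * lin y ^ (n - 1))) = n * ℓ (lin ξ * lin y ^ n) := by
      cases n with
      | zero => simp
      | succ n => rw [Nat.add_sub_cancel, pow_succ', mul_left_comm (lin ξ)]
    have h3 : ∀ j, fderiv ℝ (fun y : E d => (ℓ.comp (LinearMap.mulLeft ℂ (X j))) (lin y ^ n)) y ξ
        = n * ℓ (X j * (lin ξ * lin y ^ (n - 1))) := fun j => by rw [ih]; simp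
    simp only [_root_.sum_apply, _root_.add_apply, _root_.smul_apply, h3, smul_eq_mul,
      Finset.sum_add_distrib, mul_left_comm _ (n : ℂ), ← Finset.mul_sum, h1, h2]
    have h4 := h1 ξ (lin y ^ n)
    simp only [mul_comm _ (ℓ _)] at h4
    simp only [LinearMap.comp_apply, LinearMap.mulLeft_apply, ContinuousLinearMap.comp_apply,
      Complex.ofRealCLM_apply, PiLp.proj_apply, mul_comm _ (ℓ _), h4]
    rw [Nat.add_sub_cancel]
    push_cast
    ring

theorem laplacian_linearMap_lin_pow (ℓ : Poly d →ₗ[ℂ] ℂ) (n : ℕ) :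
    Laplacian.laplacian (fun y : E d => ℓ (lin y ^ n))
      = fun y => ((n * (n - 1) : ℕ) • ℓ.comp (LinearMap.mulLeft ℂ (normSq d)))
          (lin y ^ (n - 2)) := by
  rw [InnerProductSpace.laplacian_eq_iteratedFDeriv_orthonormalBasis _
    (EuclideanSpace.basisFun (Fin d) ℝ)]
  ext y
  have h1 : ∀ v : E d, iteratedFDeriv ℝ 2 (fun y : E d => ℓ (lin y ^ n)) y ![v, v]
      = n * ((n - 1 : ℕ) * ℓ (lin v * (lin v * lin y ^ (n - 2)))) := fun v => by
    rw [iteratedFDeriv_two_apply]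
    simp only [Matrix.cons_val_zero, Matrix.cons_val_one]
    have hd : DifferentiableAt ℝ (fderiv ℝ fun y : E d => ℓ (lin y ^ n)) y :=
      ((contDiff_linearMap_lin_pow ℓ n (N := 2)).fderiv_right (m := 1) le_rfl).differentiable
        one_ne_zero y
    have h2 : fderiv ℝ (fderiv ℝ fun y : E d => ℓ (lin y ^ n)) y v v
        = fderiv ℝ (fun z => fderiv ℝ (fun y : E d => ℓ (lin y ^ n)) z v) y v := by
      rw [fderiv_clm_apply hd (differentiableAt_const v)]
      simp
    have h3 : (fun z => fderiv ℝ (fun y : E d => ℓ (lin y ^ n)) z v)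
        = fun z => ((n : ℂ) • ℓ.comp (LinearMap.mulLeft ℂ (lin v))) (lin z ^ (n - 1)) := by
      ext z; rw [fderiv_linearMap_lin_pow]; simp
    rw [h2, h3, fderiv_linearMap_lin_pow, Nat.sub_sub]
    simp [mul_left_comm]
  simp only [h1, EuclideanSpace.basisFun_apply, lin_single]
  rw [← Finset.mul_sum, ← Finset.mul_sum, ← map_sum]
  have h4 : ∑ j, X j * (X j * lin y ^ (n - 2)) = normSq d * lin y ^ (n - 2) := by
    rw [normSq, Finset.sum_mul]
    exact Finset.sum_congr rfl fun j _ => by ring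
  rw [h4]
  simp [mul_assoc]

theorem iterate_laplacian_linearMap_lin_pow (ℓ : Poly d →ₗ[ℂ] ℂ) (n m : ℕ) (y : E d) :
    ((fun g : E d → ℂ => Laplacian.laplacian g)^[m] fun y : E d => ℓ (lin y ^ n)) y
      = n.descFactorial (2 * m) * ℓ (normSq d ^ m * lin y ^ (n - 2 * m)) := by
  induction m generalizing n ℓ with
  | zero => simp
  | succ m ih =>
    rw [Function.iterate_succ_apply, laplacian_linearMap_lin_pow, ih]
    -- For n = 0 and n = 1 both sides vanish, so the truncated subtraction does no harm.
    have h1 : n * (n - 1) * (n - 2).descFactorial (2 * m) = n.descFactorial (2 * (m + 1)) := by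
      rcases n with _ | _ | n
      · rw [zero_mul, zero_mul]; exact (Nat.descFactorial_of_lt (by omega)).symm
      · rw [Nat.descFactorial_of_lt (n := 0 + 1) (by omega)]; simp
      · rw [show 2 * (m + 1) = 2 * m + 1 + 1 by ring, Nat.succ_descFactorial_succ,
          Nat.succ_descFactorial_succ, ← mul_assoc]
        rfl
    rw [← h1, Nat.sub_sub, show 2 + 2 * m = 2 * (m + 1) by ring]
    simp [pow_succ', mul_assoc, mul_comm, mul_left_comm]

end WeakCalculus

/-! ### The transform of a polynomial times exp(-‖·‖²/2 + ⟨·, y⟩). -/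

section GaussKernel

/-- The coefficient of `‖·‖^{2m} ⟨·, y⟩^l` in the expansion of `exp(-‖·‖²/2 + ⟨·, y⟩)`. -/
def gaussCoeff (i : ℕ × ℕ) : ℂ :=
  (-1 / 2 : ℂ) ^ i.1 / (i.1.factorial : ℂ) * (1 / (i.2.factorial : ℂ))

/-- The terms of the expansion of `q · exp(-‖·‖²/2 + ⟨·, y⟩)`, transformed by `V`. -/
def gaussPoly (V : Poly d ≃ₗ[ℂ] Poly d) (q : Poly d) (y : E d) (i : ℕ × ℕ) : Poly d :=
  gaussCoeff i • V (q * normSq d ^ i.1 * lin y ^ i.2)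

/-- `gaussPoly` as a polynomial in both variables. -/
def gaussPairPoly (V : Poly d ≃ₗ[ℂ] Poly d) (q : Poly d) (i : ℕ × ℕ) :
    MvPolynomial (Fin d ⊕ Fin d) ℂ :=
  gaussCoeff i • ∑ f : Fin i.2 → Fin d,
    rename Sum.inl (V (q * normSq d ^ i.1 * ∏ s, X (f s))) * ∏ s, X (Sum.inr (f s))

/-- The coordinates on `ℝ^d × ℝ^d`. -/
def pairCoord (d : ℕ) : Fin d ⊕ Fin d → (E d × E d) →L[ℝ] ℝ :=
  Sum.elim (fun i => (EuclideanSpace.proj i : E d →L[ℝ] ℝ).comp (.fst ℝ _ _))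
    (fun i => (EuclideanSpace.proj i : E d →L[ℝ] ℝ).comp (.snd ℝ _ _))

theorem norm_pairCoord_le (i : Fin d ⊕ Fin d) : ‖pairCoord d i‖ ≤ 1 := by
  refine ContinuousLinearMap.opNorm_le_bound _ zero_le_one fun z => ?_
  rw [one_mul]
  rcases i with i | i
  · exact (PiLp.norm_apply_le z.1 i).trans (norm_fst_le z)
  · exact (PiLp.norm_apply_le z.2 i).trans (norm_snd_le z)

variable {V : Poly d ≃ₗ[ℂ] Poly d}

/-- Expanding ⟨·, y⟩^l over all words of length l in the coordinates separates y from the argument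
of V, which makes each term a polynomial in (x, y). -/
theorem realEval_gaussPairPoly (q : Poly d) (i : ℕ × ℕ) (z : E d × E d) :
    realEval (pairCoord d) (gaussPairPoly V q i) z = polyFun (gaussPoly V q z.2 i) z.1 := by
  have h1 : lin z.2 ^ i.2 = ∑ f : Fin i.2 → Fin d,
      (∏ s, ((z.2 (f s) : ℝ) : ℂ)) • ∏ s, (X (f s) : Poly d) := by
    rw [lin_eq_sum_smul, Fintype.sum_pow]
    exact Finset.sum_congr rfl fun f _ => by rw [Finset.prod_smul]
  rw [gaussPoly, h1, Finset.mul_sum, map_sum, polyFun_eq, evalAt_smul, map_sum]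
  simp only [gaussPairPoly, realEval, smul_eval, map_sum, map_mul, map_prod, eval_X, eval_rename,
    mul_smul_comm, map_smul, evalAt_smul]
  congr 1
  refine Finset.sum_congr rfl fun f _ => ?_
  rw [mul_comm]
  rfl

theorem wnorm_normSq_le {r : ℝ} (hr : 0 ≤ r) : wnorm r (normSq d) ≤ d * r ^ 2 := by
  refine (wnorm_sum_le hr _ _).trans ?_
  have h : ∀ j ∈ (Finset.univ : Finset (Fin d)), wnorm r ((X j : Poly d) ^ 2) ≤ r ^ 2 :=
    fun j _ => (wnorm_pow_le hr _ _).trans_eq (by rw [wnorm_X])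
  exact (Finset.sum_le_sum h).trans_eq (by simp)

theorem norm_gaussCoeff_le (i : ℕ × ℕ) :
    ‖gaussCoeff i‖ ≤ 1 / (i.1.factorial : ℝ) * (1 / (i.2.factorial : ℝ)) := by
  rw [gaussCoeff, norm_mul, norm_div, norm_pow, norm_div, norm_div, norm_neg, norm_one,
    RCLike.norm_natCast, RCLike.norm_natCast]
  gcongr
  refine pow_le_one₀ (by positivity) ?_
  norm_num

/-- V costs a constant C and a dilation A of the radius. With the d^l words of length l, the terms
are dominated by a product of two exponential series. -/
theorem entireFamily_gaussPairPoly {C A : ℝ} (hC : 0 ≤ C) (hA : 1 ≤ A)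
    (hV : ∀ (r : ℝ) (p : Poly d), 0 ≤ r → wnorm r (V p) ≤ C * wnorm (A * r) p) (q : Poly d) :
    EntireFamily (gaussPairPoly V q) := by
  intro r hr
  have hr0 : 0 ≤ r := zero_le_one.trans hr
  have hs0 : 0 ≤ A * r := mul_nonneg (zero_le_one.trans hA) hr0
  have hsum : Summable fun i : ℕ × ℕ => (d * (A * r) ^ 2) ^ i.1 / (i.1.factorial : ℝ) *
      ((d * (A * r * r)) ^ i.2 / (i.2.factorial : ℝ)) :=
    (Real.summable_pow_div_factorial _).mul_of_nonneg (Real.summable_pow_div_factorial _)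
      (fun n => by positivity) (fun n => by positivity)
  refine Summable.of_nonneg_of_le (fun _ => wnorm_nonneg hr0 _) (fun i => ?_)
    (hsum.mul_left (C * wnorm (A * r) q))
  have h1 : ∀ f ∈ (Finset.univ : Finset (Fin i.2 → Fin d)),
      wnorm r (rename Sum.inl (V (q * normSq d ^ i.1 * ∏ s, X (f s))) *
        ∏ s, (X (Sum.inr (f s)) : MvPolynomial (Fin d ⊕ Fin d) ℂ))
      ≤ C * (wnorm (A * r) q * (d * (A * r) ^ 2) ^ i.1 * (A * r) ^ i.2) * r ^ i.2 := fun f _ => by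
    refine (wnorm_mul_le hr0 _ _).trans (mul_le_mul ?_ ?_ (wnorm_nonneg hr0 _) ?_)
    · refine (wnorm_rename_le hr0 _ _).trans ((hV r _ hr0).trans ?_)
      refine mul_le_mul_of_nonneg_left ?_ hC
      refine (wnorm_mul_le hs0 _ _).trans (mul_le_mul ?_ ?_ (wnorm_nonneg hs0 _) ?_)
      · refine (wnorm_mul_le hs0 _ _).trans (mul_le_mul_of_nonneg_left ?_ (wnorm_nonneg hs0 _))
        exact (wnorm_pow_le hs0 _ _).trans
          (pow_le_pow_left₀ (wnorm_nonneg hs0 _) (wnorm_normSq_le hs0) _)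
      · refine (wnorm_prod_le hs0 _ _).trans ?_
        simp [wnorm_X]
      · exact mul_nonneg (wnorm_nonneg hs0 _) (by positivity)
    · refine (wnorm_prod_le hr0 _ _).trans ?_
      simp [wnorm_X]
    · have := wnorm_nonneg hs0 q
      positivity
  have hq := wnorm_nonneg hs0 q
  rw [gaussPairPoly, wnorm_smul]
  calc _ ≤ (1 / (i.1.factorial : ℝ) * (1 / (i.2.factorial : ℝ))) *
        ∑ f : Fin i.2 → Fin d,
          C * (wnorm (A * r) q * (d * (A * r) ^ 2) ^ i.1 * (A * r) ^ i.2) * r ^ i.2 :=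
        mul_le_mul (norm_gaussCoeff_le i)
          ((wnorm_sum_le hr0 _ _).trans (Finset.sum_le_sum h1)) (wnorm_nonneg hr0 _)
          (by positivity)
    _ = _ := by
        rw [Finset.sum_const, Finset.card_univ, Fintype.card_fun, Fintype.card_fin,
          Fintype.card_fin, nsmul_eq_mul]
        push_cast
        rw [mul_pow (d : ℝ) (A * r * r), mul_pow (A * r) r]
        ring

/-- `V (q · exp(-‖·‖²/2 + ⟨·, y⟩)) (x)`. -/
def gaussKernel (V : Poly d ≃ₗ[ℂ] Poly d) (q : Poly d) (x y : E d) : ℂ :=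
  ∑' i, polyFun (gaussPoly V q y i) x

variable {q : Poly d}

theorem gaussKernel_eq (V : Poly d ≃ₗ[ℂ] Poly d) (q : Poly d) :
    (fun z : E d × E d => gaussKernel V q z.1 z.2)
      = fun z => ∑' i, realEval (pairCoord d) (gaussPairPoly V q i) z := by
  simp only [realEval_gaussPairPoly, gaussKernel]

theorem hasSum_gaussKernel (hP : EntireFamily (gaussPairPoly V q)) (x y : E d) :
    HasSum (fun i => polyFun (gaussPoly V q y i) x) (gaussKernel V q x y) := by
  have h := hP.summable norm_pairCoord_le (x, y)
  simp only [realEval_gaussPairPoly] at h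
  exact h.hasSum

theorem contDiff_gaussKernel (hP : EntireFamily (gaussPairPoly V q)) :
    ContDiff ℝ ∞ fun z : E d × E d => gaussKernel V q z.1 z.2 := by
  rw [gaussKernel_eq]
  exact hP.contDiff_tsum norm_pairCoord_le

theorem differentiable_gaussKernel (hP : EntireFamily (gaussPairPoly V q)) :
    Differentiable ℝ fun z : E d × E d => gaussKernel V q z.1 z.2 :=
  (contDiff_gaussKernel hP).differentiable (by simp)

theorem hasSum_fderiv_gaussKernel (hP : EntireFamily (gaussPairPoly V q)) (z v : E d × E d) :
    HasSum (fun i => fderiv ℝ (fun z : E d × E d => polyFun (gaussPoly V q z.2 i) z.1) z v)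
      (fderiv ℝ (fun z : E d × E d => gaussKernel V q z.1 z.2) z v) := by
  have h := hP.hasSum_fderiv norm_pairCoord_le z v
  rw [← gaussKernel_eq] at h
  have h1 : ∀ i, realEval (pairCoord d) (gaussPairPoly V q i)
      = fun z : E d × E d => polyFun (gaussPoly V q z.2 i) z.1 := fun i =>
    funext (realEval_gaussPairPoly q i)
  simpa only [h1] using h

theorem differentiable_gaussPoly (V : Poly d ≃ₗ[ℂ] Poly d) (q : Poly d) (i : ℕ × ℕ) :
    Differentiable ℝ fun z : E d × E d => polyFun (gaussPoly V q z.2 i) z.1 := by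
  simp only [← realEval_gaussPairPoly]
  exact fun z => (hasFDerivAt_realEval _ _ z).differentiableAt

theorem fderiv_left {f : E d × E d → ℂ} (hf : Differentiable ℝ f) (x y ξ : E d) :
    fderiv ℝ (fun w => f (w, y)) x ξ = fderiv ℝ f (x, y) (ξ, 0) := by
  have h := HasFDerivAt.comp (g := f) (f := fun w => (w, y)) x (hf (x, y)).hasFDerivAt
    (hasFDerivAt_prodMk_left x y)
  have h' : fderiv ℝ (fun w => f (w, y)) x = _ := h.fderiv
  rw [h']; simp

theorem fderiv_right {f : E d × E d → ℂ} (hf : Differentiable ℝ f) (x y ξ : E d) :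
    fderiv ℝ (fun w => f (x, w)) y ξ = fderiv ℝ f (x, y) (0, ξ) := by
  have h := HasFDerivAt.comp (g := f) (f := fun w => (x, w)) y (hf (x, y)).hasFDerivAt
    (hasFDerivAt_prodMk_right x y)
  have h' : fderiv ℝ (fun w => f (x, w)) y = _ := h.fderiv
  rw [h']; simp

theorem hasSum_fderiv_left (hP : EntireFamily (gaussPairPoly V q)) (x y ξ : E d) :
    HasSum (fun i => fderiv ℝ (polyFun (gaussPoly V q y i)) x ξ)
      (fderiv ℝ (fun w => gaussKernel V q w y) x ξ) := by
  rw [fderiv_left (differentiable_gaussKernel hP)]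
  convert! hasSum_fderiv_gaussKernel hP (x, y) (ξ, 0) using 2 with i
  exact fderiv_left (differentiable_gaussPoly V q i) x y ξ

theorem hasSum_fderiv_right (hP : EntireFamily (gaussPairPoly V q)) (x y ξ : E d) :
    HasSum (fun i => fderiv ℝ (fun w => polyFun (gaussPoly V q w i) x) y ξ)
      (fderiv ℝ (fun w => gaussKernel V q x w) y ξ) := by
  rw [fderiv_right (differentiable_gaussKernel hP)]
  convert! hasSum_fderiv_gaussKernel hP (x, y) (0, ξ) using 2 with i
  exact fderiv_right (differentiable_gaussPoly V q i) x y ξ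

/-- The Dunkl operator at x sees only values and first derivatives, on and off the hyperplanes, so
it passes through the sum. -/
theorem hasSum_dunklOp {ι : Type*} {f : ι → E d → ℂ} {g : E d → ℂ} {x : E d}
    (hf : ∀ w, HasSum (fun i => f i w) (g w))
    (hf' : ∀ v, HasSum (fun i => fderiv ℝ (f i) x v) (fderiv ℝ g x v))
    (S : Finset (E d)) (k : E d → ℂ) (ξ : E d) :
    HasSum (fun i => dunklOp S k ξ (f i) x) (dunklOp S k ξ g x) := by
  refine (hf' ξ).add (hasSum_sum fun α _ => HasSum.mul_left _ ?_)
  unfold differenceQuotient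
  split_ifs
  · exact (hf' α).mul_left _
  · exact ((hf x).sub (hf _)).div_const _

theorem gaussCoeff_succ_left (m l : ℕ) :
    gaussCoeff (m + 1, l) * (2 * (m + 1)) = -gaussCoeff (m, l) := by
  have h : ((m + 1 : ℕ) : ℂ) ≠ 0 := by exact_mod_cast Nat.succ_ne_zero m
  have h' : (m.factorial : ℂ) ≠ 0 := by exact_mod_cast m.factorial_ne_zero
  simp only [gaussCoeff, Nat.factorial_succ, Nat.cast_mul, pow_succ]
  push_cast at h ⊢
  field_simp

theorem gaussCoeff_succ_right (m l : ℕ) :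
    gaussCoeff (m, l + 1) * (l + 1) = gaussCoeff (m, l) := by
  have h : ((l + 1 : ℕ) : ℂ) ≠ 0 := by exact_mod_cast Nat.succ_ne_zero l
  have h' : (l.factorial : ℂ) ≠ 0 := by exact_mod_cast l.factorial_ne_zero
  simp only [gaussCoeff, Nat.factorial_succ, Nat.cast_mul]
  push_cast at h ⊢
  field_simp

/-- Reindexing along an injection outside whose range g vanishes. The shift in m accounts for
differentiating exp(-‖·‖²/2), the one in l for differentiating exp⟨·, y⟩. -/
theorem hasSum_shift_left {f g : ℕ × ℕ → ℂ} {a : ℂ} (hf : HasSum f a)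
    (h0 : ∀ l, g (0, l) = 0) (h1 : ∀ m l, g (m + 1, l) = f (m, l)) : HasSum g a := by
  have hinj : Function.Injective fun i : ℕ × ℕ => (i.1 + 1, i.2) := by
    rintro ⟨m, l⟩ ⟨m', l'⟩ h
    simpa using h
  refine (hinj.hasSum_iff ?_).mp ?_
  · rintro ⟨m, l⟩ h
    cases m with
    | zero => exact h0 l
    | succ m => exact absurd ⟨(m, l), rfl⟩ h
  · convert! hf using 1
    ext i; exact h1 i.1 i.2

theorem hasSum_shift_right {f g : ℕ × ℕ → ℂ} {a : ℂ} (hf : HasSum f a)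
    (h0 : ∀ m, g (m, 0) = 0) (h1 : ∀ m l, g (m, l + 1) = f (m, l)) : HasSum g a := by
  have hinj : Function.Injective fun i : ℕ × ℕ => (i.1, i.2 + 1) := by
    rintro ⟨m, l⟩ ⟨m', l'⟩ h
    simpa using h
  refine (hinj.hasSum_iff ?_).mp ?_
  · rintro ⟨m, l⟩ h
    cases l with
    | zero => exact h0 m
    | succ l => exact absurd ⟨(m, l), rfl⟩ h
  · convert! hf using 1
    ext i; exact h1 i.1 i.2

theorem fderiv_gaussKernel_right (hP : ∀ q, EntireFamily (gaussPairPoly V q)) (x y ξ : E d) :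
    fderiv ℝ (fun w => gaussKernel V 1 x w) y ξ = gaussKernel V (lin ξ) x y := by
  refine (hasSum_fderiv_right (hP 1) x y ξ).unique ?_
  have h1 : ∀ m l, fderiv ℝ (fun w => polyFun (gaussPoly V 1 w (m, l)) x) y ξ
      = gaussCoeff (m, l) * (l * evalAt x (V (normSq d ^ m * (lin ξ * lin y ^ (l - 1))))) :=
    fun m l => by
      -- For fixed x and m the dependence on y is only through ⟨·, y⟩^l, so the term is a linear
      -- functional of that power.
      let ℓ : Poly d →ₗ[ℂ] ℂ := (aeval fun i => ((x i : ℝ) : ℂ)).toLinearMap.comp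
        (V.toLinearMap.comp (LinearMap.mulLeft ℂ (gaussCoeff (m, l) • normSq d ^ m)))
      have hℓ : ∀ p, ℓ p = gaussCoeff (m, l) * evalAt x (V (normSq d ^ m * p)) := fun p => by
        simp [ℓ, evalAt, aeval_eq_eval]
      have h2 : (fun w => polyFun (gaussPoly V 1 w (m, l)) x) = fun w => ℓ (lin w ^ l) := by
        ext w
        rw [hℓ, gaussPoly, polyFun_eq, evalAt_smul, one_mul]
      rw [h2, fderiv_linearMap_lin_pow, hℓ]
      ring
  refine hasSum_shift_right (hasSum_gaussKernel (hP (lin ξ)) x y) (fun m => ?_) fun m l => ?_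
  · rw [h1]; simp
  · rw [h1, gaussPoly, polyFun_eq, evalAt_smul, ← gaussCoeff_succ_right m l, Nat.add_sub_cancel,
      mul_left_comm (normSq d ^ m), mul_assoc (lin ξ)]
    push_cast
    ring

/-- Intertwining turns T_ξ into ∂_ξ under V, and the exponent has derivative -⟨ξ, ·⟩ + ⟨ξ, y⟩. The
two summands are recovered by shifting m and l respectively. -/
theorem dunklOp_gaussKernel {S : Finset (E d)} {k : E d → ℂ} (hS : (0 : E d) ∉ S)
    (hV : IsIntertwining S k V) (hP : ∀ q, EntireFamily (gaussPairPoly V q)) (x y ξ : E d) :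
    dunklOp S k ξ (fun w => gaussKernel V 1 w y) x
      = -gaussKernel V (lin ξ) x y + ((⟪ξ, y⟫_ℝ : ℝ) : ℂ) * gaussKernel V 1 x y := by
  refine (hasSum_dunklOp (fun w => hasSum_gaussKernel (hP 1) w y)
    (fun v => hasSum_fderiv_left (hP 1) x y v) S k ξ).unique ?_
  have h1 : ∀ m l, dunklOp S k ξ (polyFun (gaussPoly V 1 y (m, l))) x
      = gaussCoeff (m, l) * (2 * m * evalAt x (V (lin ξ * normSq d ^ (m - 1) * lin y ^ l)))
        + gaussCoeff (m, l) *
          (l * ((⟪ξ, y⟫_ℝ : ℝ) : ℂ) * evalAt x (V (normSq d ^ m * lin y ^ (l - 1)))) :=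
    fun m l => by
      have h2 : dirD ξ (normSq d ^ m * lin y ^ l)
          = (2 * m : ℂ) • (lin ξ * normSq d ^ (m - 1) * lin y ^ l)
            + (l * ((⟪ξ, y⟫_ℝ : ℝ) : ℂ)) • (normSq d ^ m * lin y ^ (l - 1)) := by
        rw [Derivation.leibniz, Derivation.leibniz_pow, Derivation.leibniz_pow, dirD_lin,
          dirD_normSq]
        simp only [smul_eq_mul, nsmul_eq_mul, smul_eq_C_mul, map_mul, map_natCast]
        ring
      rw [dunklOp_polyFun hS, gaussPoly, map_smul, one_mul, hV.dunklPoly hS, h2, polyFun_eq,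
        evalAt_smul, map_add, map_add, V.map_smul, V.map_smul, evalAt_smul, evalAt_smul, mul_add]
  simp only [fun i : ℕ × ℕ => h1 i.1 i.2]
  refine HasSum.add ?_ ?_
  · refine hasSum_shift_left (hasSum_gaussKernel (hP (lin ξ)) x y).neg (fun l => ?_) fun m l => ?_
    · simp
    · rw [gaussPoly, polyFun_eq, evalAt_smul, ← neg_mul, ← gaussCoeff_succ_left m l,
        Nat.add_sub_cancel]
      push_cast
      ring
  · refine hasSum_shift_right ((hasSum_gaussKernel (hP 1) x y).mul_left _) (fun m => ?_)
      fun m l => ?_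
    · simp
    · rw [gaussPoly, polyFun_eq, evalAt_smul, ← gaussCoeff_succ_right m l, Nat.add_sub_cancel, one_mul]
      push_cast
      ring

end GaussKernel

/-! ### Identification of L_k with the transformed Gaussian. -/

section KernelL

theorem expNegHalfLaplacian_term (x y : E d) (n m : ℕ) :
    ((-1 / 2 : ℂ) ^ m / (m.factorial : ℂ)) *
      ((fun g : E d → ℂ => Laplacian.laplacian g)^[m] fun z => kernelE S k n x z) y
    = if 2 * m ≤ n then polyFun (gaussPoly (intertwiningOp S k) 1 y (m, n - 2 * m)) x else 0 := by
  let ℓ : Poly d →ₗ[ℂ] ℂ := (1 / (n.factorial : ℂ)) •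
    (aeval fun i => ((x i : ℝ) : ℂ)).toLinearMap.comp (intertwiningOp S k).toLinearMap
  have hℓ : ∀ p, ℓ p = (1 / (n.factorial : ℂ)) * evalAt x (intertwiningOp S k p) := fun p => by
    simp [ℓ, evalAt, aeval_eq_eval]
  have h1 : (fun z => kernelE S k n x z) = fun z => ℓ (lin z ^ n) := by
    ext z; rw [hℓ]; rfl
  rw [h1, iterate_laplacian_linearMap_lin_pow, hℓ]
  split_ifs with h
  · rw [gaussPoly, polyFun_eq, evalAt_smul, one_mul, gaussCoeff]
    -- The 2m-fold differentiation produces n!/(n - 2m)!, which turns the 1/n! of E_n into the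
    -- coefficient 1/l! with l = n - 2m.
    have h2 : (((n - 2 * m).factorial : ℕ) : ℂ) * (n.descFactorial (2 * m) : ℕ)
        = (n.factorial : ℕ) := by
      rw [← Nat.factorial_mul_descFactorial h]; push_cast; rfl
    have h3 : (n.factorial : ℂ) ≠ 0 := by exact_mod_cast n.factorial_ne_zero
    have h4 : ((n - 2 * m).factorial : ℂ) ≠ 0 := by exact_mod_cast (n - 2 * m).factorial_ne_zero
    have h5 : (n.descFactorial (2 * m) : ℂ) * (1 / (n.factorial : ℂ))
        = 1 / ((n - 2 * m).factorial : ℂ) := by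
      field_simp
      linear_combination h2
    rw [← h5]
    simp only
    ring
  · rw [Nat.descFactorial_of_lt (by omega)]; simp

theorem hasSum_kernelLTerm (hP : EntireFamily (gaussPairPoly (intertwiningOp S k) 1)) (x y : E d) :
    HasSum (kernelLTerm S k x y) (gaussKernel (intertwiningOp S k) 1 x y) := by
  let G : ℕ × ℕ → ℂ := fun i =>
    if 2 * i.2 ≤ i.1 then polyFun (gaussPoly (intertwiningOp S k) 1 y (i.2, i.1 - 2 * i.2)) x else 0
  -- The absolutely convergent double series over (m, l) is regrouped by the total degree n = 2m +
  -- l.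
  have hinj : Function.Injective fun i : ℕ × ℕ => (2 * i.1 + i.2, i.1) := by
    rintro ⟨m, l⟩ ⟨m', l'⟩ h
    simp only [Prod.mk.injEq] at h ⊢
    omega
  have hG : HasSum G (gaussKernel (intertwiningOp S k) 1 x y) := by
    refine (hinj.hasSum_iff ?_).mp ?_
    · rintro ⟨n, m⟩ h
      refine if_neg fun hle => h ⟨(m, n - 2 * m), ?_⟩
      simp only [Prod.mk.injEq, and_true]
      simp only at hle
      omega
    · convert! hasSum_gaussKernel hP x y using 1
      ext ⟨m, l⟩
      simp [G]
  refine hG.prod_fiberwise fun n => ?_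
  have h : kernelLTerm S k x y n = ∑' m, G (n, m) :=
    tsum_congr fun m => expNegHalfLaplacian_term x y n m
  rw [h]
  exact (hG.summable.prod_factor n).hasSum

theorem dunklOp_mul_const {f : E d → ℂ} {x : E d} (hf : DifferentiableAt ℝ f x) (c : ℂ)
    (ξ : E d) : dunklOp S k ξ (fun w => f w * c) x = dunklOp S k ξ f x * c := by
  have h : ∀ v, fderiv ℝ (fun w => f w * c) x v = fderiv ℝ f x v * c := fun v => by
    rw [fderiv_mul_const hf]; simp [mul_comm]
  simp only [dunklOp, differenceQuotient, h, add_mul, Finset.sum_mul]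
  congr 1
  refine Finset.sum_congr rfl fun α _ => ?_
  split_ifs <;> ring

theorem fderiv_mul_gaussian {f : E d → ℂ} {y : E d} (hf : DifferentiableAt ℝ f y) (ξ : E d) :
    fderiv ℝ (fun z => f z * ((Real.exp (-‖z‖ ^ 2 / 2) : ℝ) : ℂ)) y ξ
      = (fderiv ℝ f y ξ - ((⟪ξ, y⟫_ℝ : ℝ) : ℂ) * f y) *
        ((Real.exp (-‖y‖ ^ 2 / 2) : ℝ) : ℂ) := by
  have h0 : HasFDerivAt (fun z : E d => -‖z‖ ^ 2 / 2) _ y :=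
    ((hasStrictFDerivAt_norm_sq y).hasFDerivAt.const_mul (-1 / 2)).congr_of_eventuallyEq
      (.of_forall fun z => by ring)
  have h1 : HasFDerivAt (fun z : E d => Real.exp (-‖z‖ ^ 2 / 2)) _ y := h0.exp
  have h2 : HasFDerivAt (fun z : E d => ((Real.exp (-‖z‖ ^ 2 / 2) : ℝ) : ℂ)) _ y :=
    Complex.ofRealCLM.hasFDerivAt.comp y h1
  rw [(hf.hasFDerivAt.fun_mul h2).fderiv]
  simp [real_inner_comm]
  ring

end KernelL

end

end Dunkl

theorem mainTheorem7 (d : ℕ) (R : Finset (Dunkl.E d)) (hR : Dunkl.IsRootSystem R)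
    (β : Dunkl.E d) (hβ : ∀ α ∈ R, ⟪α, β⟫_ℝ ≠ 0)
    (k : Dunkl.E d → ℂ) (hk : Dunkl.IsParameter R k)
    (hkM : Dunkl.MStar (Dunkl.positiveRoots R β) k) :
    (∃! V : MvPolynomial (Fin d) ℂ ≃ₗ[ℂ] MvPolynomial (Fin d) ℂ,
      Dunkl.IsIntertwining (Dunkl.positiveRoots R β) k V) ∧
    (∀ x y : Dunkl.E d, Summable (Dunkl.kernelLTerm (Dunkl.positiveRoots R β) k x y)) ∧
    ContDiff ℝ ∞ (fun q : Dunkl.E d × Dunkl.E d =>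
      Dunkl.kernelL (Dunkl.positiveRoots R β) k q.1 q.2) ∧
    ∀ (x y : Dunkl.E d) (j : Fin d),
      fderiv ℝ (fun z : Dunkl.E d => Dunkl.kernelL (Dunkl.positiveRoots R β) k x z *
          ((Real.exp (-‖z‖ ^ 2 / 2) : ℝ) : ℂ)) y (EuclideanSpace.single j 1) =
        -Dunkl.dunklOp (Dunkl.positiveRoots R β) k (EuclideanSpace.single j 1)
          (fun w : Dunkl.E d => Dunkl.kernelL (Dunkl.positiveRoots R β) k w y *
            ((Real.exp (-‖y‖ ^ 2 / 2) : ℝ) : ℂ)) x := by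
  have hS := Dunkl.zero_notMem_positiveRoots R β
  have hE := Dunkl.equivariant_positiveRoots hR hβ hk
  have hW := hkM.eulerInjective
  have hV := Dunkl.isIntertwining_intertwiningOp hS hE hW
  obtain ⟨C, A, hC, hA, hCA⟩ := hV.exists_wnorm_le hS
  have hP := Dunkl.entireFamily_gaussPairPoly hC hA hCA
  have hL : ∀ x y, Dunkl.kernelL (Dunkl.positiveRoots R β) k x y
      = Dunkl.gaussKernel (Dunkl.intertwiningOp (Dunkl.positiveRoots R β) k) 1 x y :=
    fun x y => (Dunkl.hasSum_kernelLTerm (hP 1) x y).tsum_eq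
  have hd := Dunkl.differentiable_gaussKernel (hP 1)
  refine ⟨⟨_, hV, fun V' hV' => hV'.eq hS hW hV⟩,
    fun x y => (Dunkl.hasSum_kernelLTerm (hP 1) x y).summable, ?_, fun x y j => ?_⟩
  · simp only [hL]
    exact Dunkl.contDiff_gaussKernel (hP 1)
  · simp only [hL]
    have hx : DifferentiableAt ℝ (fun w => Dunkl.gaussKernel
        (Dunkl.intertwiningOp (Dunkl.positiveRoots R β) k) 1 w y) x :=
      (hd (x, y)).comp (f := fun w => (w, y)) x (hasFDerivAt_prodMk_left x y).differentiableAt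
    have hy : DifferentiableAt ℝ (fun w => Dunkl.gaussKernel
        (Dunkl.intertwiningOp (Dunkl.positiveRoots R β) k) 1 x w) y :=
      (hd (x, y)).comp (f := fun w => (x, w)) y (hasFDerivAt_prodMk_right x y).differentiableAt
    -- Both sides become (K(⟨e_j, ·⟩) - ⟨e_j, y⟩ K(1)) e^{-‖y‖²/2}: in x the Gaussian is a constant,
    -- in y its derivative supplies the second term.
    rw [Dunkl.fderiv_mul_gaussian hy, Dunkl.dunklOp_mul_const hx,
      Dunkl.fderiv_gaussKernel_right hP, Dunkl.dunklOp_gaussKernel hS hV hP]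
    ring
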